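/- **Setting.** Let $m\ge 2$, $\ell=\ell_m=\lfloor\log_2 m\rfloor$ and $\ell\le d$. Let $f:\mathbb R^d\to\mathbb R$ be $\alpha$-strongly convex and $\beta$-smooth (differentiable with $\beta$-Lipschitz gradient), $\alpha,\beta>0$. Let $\mathcal D\subseteq\mathbb R^d$ be closed and convex and contain the minimizer $x^*$ of $f$. The function is accessible only through noiseless multiwise-winner feedback: a query is a set of at most $m$ points, and the answer is (the label of) a point of smallest $f$-value in it, ties being broken by an arbitrary measurable rule; for a pair $(x,y)$ the answer is $\operatorname{sign}(f(x)-f(y))$, with $\operatorname{sign}(0)=+1$. **Battling-NGD**$(w_1,\eta,\gamma,T)$. Put $\mathbf m_1=w_1$. For $t=1,\dots,T$: sample $u_t^1,\dots,u_t^{\ell}$ independently and uniformly from the sphere of radius $1/\sqrt{\ell}$ in $\mathbb R^d$ and put $U_t=[u_t^1,\dots,u_t^\ell]$; query the set $\{w_t+\gamma U_tv: v\in\{\pm1\}^{\ell}\}$ and let $v$ be the label of the winner; put $g_t=\frac1\ell\sum_{i=1}^{\ell}(-v_iu_t^i)$ and let $w_{t+1}$ be the Euclidean projection of $w_t-\eta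 g_t$ onto $\mathcal D$; query the pair $(\mathbf m_t,w_{t+1})$ and put $\mathbf m_{t+1}=\mathbf m_t$ if $\operatorname{sign}(f(\mathbf m_t)-f(w_{t+1}))<0$, and $\mathbf m_{t+1}=w_{t+1}$ otherwise. Return $\mathbf m_{T+1}$. Each round makes two queries. **Improved Battling-NGD**, for a tolerance $\varepsilon>0$ and a starting point $x_1\in\mathcal D$, has $\max(1,\lceil\log_2(\alpha/\varepsilon)\rceil)$ phases. Let $t=\frac{800\,d\beta}{(\sqrt2-1)\alpha\ell}$. Phase $k$ starts at the point $x_k$ returned by phase $k-1$; the squared distance $D_k=\|x_k-x^*\|^2$ is assumed known. With $$t_1=tD_1,\qquad t_k=2t\ (k\ge2),\qquad \varepsilon_k=\frac{400\,d\beta D_k}{(\sqrt2-1)\,\ell\, t_k}$$ (so $\varepsilon_1=\alpha/2$ when $D_1>0$, and $\varepsilon_k=\alpha D_k/4$ for $k\ge2$; if $D_1=0$, put $\varepsilon_1=0$) and $$\eta_k=\frac{\ell\sqrt{\ell\,\varepsilon_k}}{20\sqrt{d\beta}},\qquad \gamma_k=\frac{\alpha}{960\,\beta d\ell\sqrt{d\ell}\,\sqrt{\log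 480}}\sqrt{\frac{2\varepsilon_k}{\beta}},$$ phase $k$ runs Battling-NGD$(x_k,\eta_k,\gamma_k,\lfloor t_k\rfloor)$; all random directions in all rounds and phases are independent. The point $\mathbf m_\varepsilon$ returned by the last phase is the output. **Theorem.** There is a universal constant $C>0$ such that, for all data as above, the output $\mathbf m_\varepsilon$ lies in $\mathcal D$, is $\varepsilon$-optimal, i.e. $f(\mathbf m_\varepsilon)$ is integrable and $$\mathbb E[f(\mathbf m_\varepsilon)]-f(x^*)\le\varepsilon,$$ and the total number of queries made is always at most $$C\,\frac{d\beta}{\alpha\,\ell_m}\Big(\max\{\log_2(\alpha/\varepsilon),0\}+\|x_1-x^*\|^2\Big).$$ -/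

import Mathlib

open MeasureTheory ProbabilityTheory

/-- The Euclidean space `ℝ^d`. -/
abbrev Pt (d : ℕ) : Type := EuclideanSpace ℝ (Fin d)

/-- `f : ℝ^d → ℝ` is `β`-smooth: differentiable with `β`-Lipschitz gradient. -/
def IsSmoothFn {d : ℕ} (β : ℝ) (f : Pt d → ℝ) : Prop :=
  Differentiable ℝ f ∧ ∀ x y : Pt d, ‖gradient f x - gradient f y‖ ≤ β * ‖x - y‖

/-- The uniform distribution on the sphere of radius `r` around the origin of `ℝ^d`: the
normalised surface measure of the unit sphere, pushed forward under `x ↦ r x`. -/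
noncomputable def uniformSphere (d : ℕ) (r : ℝ) : Measure (Pt d) :=
  (((volume : Measure (Pt d)).toSphere Set.univ)⁻¹ • (volume : Measure (Pt d)).toSphere).map
    (fun x : Metric.sphere (0 : Pt d) 1 => r • (x : Pt d))

/-- The Euclidean projection of `x` onto `K` (unique when `K` is nonempty, closed and convex). -/
noncomputable def euclProj {d : ℕ} (K : Set (Pt d)) (x : Pt d) : Pt d :=
  Classical.epsilon (fun p : Pt d => p ∈ K ∧ ∀ y ∈ K, ‖p - x‖ ≤ ‖y - x‖)

/-- The sign vectors `{±1}^n`. -/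
abbrev SignVec (n : ℕ) : Type := Fin n → ℤˣ

/-- Noiseless multiwise-winner feedback for `f` on query sets of `2^n` points labelled by
`{±1}^n`: the label of a point of smallest `f`-value is revealed. How ties are broken is left
open, up to measurability. -/
structure WinnerFeedback {d : ℕ} (n : ℕ) (f : Pt d → ℝ) where
  winner : (SignVec n → Pt d) → SignVec n
  isArgmin : ∀ (x : SignVec n → Pt d) (v : SignVec n), f (x (winner x)) ≤ f (x v)
  measurable : ∀ v : SignVec n, MeasurableSet {x : SignVec n → Pt d | winner x = v}

/-- Noiseless pairwise feedback `sign (f x - f y)`, with `sign 0 = 1`. -/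
noncomputable def signFeedback {d : ℕ} (f : Pt d → ℝ) (x y : Pt d) : ℝ :=
  if 0 ≤ f x - f y then 1 else -1

/-- The query point `w + γ U v`, where `U = [u_1, …, u_n]`. -/
noncomputable def queryPoint {d n : ℕ} (γ : ℝ) (w : Pt d) (u : Fin n → Pt d)
    (v : SignVec n) : Pt d :=
  w + γ • ∑ i, ((v i : ℤ) : ℝ) • u i

/-- The aggregated normalised gradient estimate `(1/n) ∑ i, (-v_i u_i)`. -/
noncomputable def gradEstimate {d n : ℕ} (u : Fin n → Pt d) (v : SignVec n) : Pt d :=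
  (n : ℝ)⁻¹ • ∑ i, (-((v i : ℤ) : ℝ)) • u i

/-- State of Battling-NGD: current point, running minimum, number of queries made so far. -/
structure NGDState (d : ℕ) where
  current : Pt d
  best : Pt d
  queries : ℕ

/-- One round of Battling-NGD with sampled directions `u`. It makes two queries: the structured
set `{w + γ U v | v ∈ {±1}^n}` and the pair (running minimum, new point). -/
noncomputable def battlingRound {d n : ℕ} {f : Pt d → ℝ} (K : Set (Pt d))
    (O : WinnerFeedback n f) (η γ : ℝ) (u : Fin n → Pt d) (s : NGDState d) : NGDState d :=
  let v := O.winner (queryPoint γ s.current u)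
  let w' := euclProj K (s.current - η • gradEstimate u v)
  { current := w'
    best := if signFeedback f s.best w' < 0 then s.best else w'
    queries := s.queries + 2 }

/-- Battling-NGD started at `w₁`, after the given number of rounds; `u t` are the directions
sampled in round `t`. The returned point is the field `best`. -/
noncomputable def battlingNGD {d n : ℕ} {f : Pt d → ℝ} (K : Set (Pt d))
    (O : WinnerFeedback n f) (η γ : ℝ) (u : ℕ → Fin n → Pt d) (w₁ : Pt d) : ℕ → NGDState d
  | 0 => { current := w₁, best := w₁, queries := 0 }
  | T + 1 => battlingRound K O η γ (u T) (battlingNGD K O η γ u w₁ T)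

/-- The unit `t = 800 d β / ((√2 - 1) α n)` of the round budgets. -/
noncomputable def budgetUnit (d n : ℕ) (α β : ℝ) : ℝ :=
  800 * d * β / ((Real.sqrt 2 - 1) * α * n)

/-- The (real-valued) round budget of phase `k + 1`: `t D` in the first phase, `2 t` later. -/
noncomputable def phaseBudget (d n : ℕ) (α β D : ℝ) (k : ℕ) : ℝ :=
  if k = 0 then budgetUnit d n α β * D else 2 * budgetUnit d n α β

/-- The accuracy `400 d β D / ((√2 - 1) n τ)` aimed at by a phase with budget `τ` whose starting
point has squared distance `D` to the minimiser. -/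
noncomputable def phaseAccuracy (d n : ℕ) (β D τ : ℝ) : ℝ :=
  400 * d * β * D / ((Real.sqrt 2 - 1) * n * τ)

/-- Learning rate of Battling-NGD for accuracy `e`. The directions have length `1/√n`. -/
noncomputable def learningRate (d n : ℕ) (β e : ℝ) : ℝ :=
  n * Real.sqrt n * Real.sqrt e / (20 * Real.sqrt (d * β))

/-- Perturbation parameter of Battling-NGD for accuracy `e`. -/
noncomputable def perturbation (d n : ℕ) (α β e : ℝ) : ℝ :=
  α / (960 * β * d * n * Real.sqrt (d * n) * Real.sqrt (Real.log 480)) * Real.sqrt (2 * e / β)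

/-- Improved Battling-NGD after the given number of phases: its current point and the number of
queries made so far. Each phase runs Battling-NGD from the point returned by the previous phase,
tuned with the squared distance `D` of that starting point to the minimiser, which is assumed
known; `u k t` are the directions sampled in round `t` of phase `k`. -/
noncomputable def improvedBattlingNGD {d n : ℕ} {f : Pt d → ℝ} (K : Set (Pt d))
    (O : WinnerFeedback n f) (α β : ℝ) (xstar : Pt d) (u : ℕ → ℕ → Fin n → Pt d) (w₁ : Pt d) :
    ℕ → Pt d × ℕ
  | 0 => (w₁, 0)
  | k + 1 =>
    let prev := improvedBattlingNGD K O α β xstar u w₁ k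
    let D := ‖prev.1 - xstar‖ ^ 2
    let τ := phaseBudget d n α β D k
    let e := phaseAccuracy d n β D τ
    let out := battlingNGD K O (learningRate d n β e) (perturbation d n α β e) (u k) prev.1 ⌊τ⌋₊
    (out.best, prev.2 + out.queries)

/-- The number `⌈log₂ (α / ε)⌉` of phases (the first phase is always carried out). -/
noncomputable def phaseCount (α ε : ℝ) : ℕ := max 1 ⌈Real.logb 2 (α / ε)⌉₊

/-!
The answer to a structured query tells, up to a small error, the signs of the directional
derivatives of `f` along the sampled directions `u_i`: changing one sign of the winning label does
not decrease `f`, so by smoothness a sign can be wrong only for a direction along which the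
derivative is at most `β γ` (`winner_mul_inner_gradient_le`). The gradient at a point far from
optimal is bounded below by strong convexity, and a uniform point of the sphere is rarely so close
to orthogonal to a given vector (`uniformSphere_slab_le`, proved by packing disjoint translates of
a slab into the ball). Hence the step of the algorithm is, but for an event of tiny probability, a
negative multiple of the sum of the directions `± u_i` aligned with the normalised gradient `g`.
The moments of this sum follow from those of the uniform distribution: the mean of `sign ⟨x, g⟩ x`
is a multiple of `g` by reflection, with a factor of order `r / √d` by the second and fourth
moments (`le_integral_abs_inner_uniformSphere`), and the second and fourth moments of the norm of
the sum are bounded by constants (`SignedDirections.integral_norm_sq_le`,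
`SignedDirections.integral_norm_pow_four_le`).

Let `Δ_s` be the suboptimality of the current point after `s` rounds, `e` the accuracy aimed at
and `Q = n e / (400 d β)` the square of `η / n` for the learning rate `η`. As long as
`Δ_s > e / 4`, the squared distance to the minimiser decreases in mean by at least
`18 Q √(Δ_s / e)`, because the cosine of the angle between the gradient and `w - xstar` is at
least `√(2 Δ_s / β) / ‖w - xstar‖` (`sqrt_mul_norm_gradient_le`). The *square* of the squared
distance plus the accumulated drift, with a compensator for the second moments of the steps, is
therefore a supermartingale (`lintegral_nextPoint_le`, `lintegral_phasePotential_succ_le`). At the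
end of a phase of `T` rounds that never met `Δ_s ≤ e / 4` the accumulated drift is at least
`18 Q T √(min Δ_s / e)`; squaring turns the supermartingale bound into one for the mean of
`min Δ_s` itself, whatever its tails, and `Q T ≥ D`, with `D` the squared distance at the start of
the phase, makes it at most `82 e / 324`. With the `e / 4` of the other event the mean
suboptimality of the best point is at most `e` (`lintegral_battlingNGD_best_le`).

Conditionally on its past, each phase attains in mean the accuracy computed from its starting
point (`lintegral_improvedBattlingNGD_succ_le`). The accuracy is `α / 2` in the first phase and
`α D / 4` afterwards, which by strong convexity is at most half the suboptimality of the starting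
point, so after `k` phases the mean suboptimality is at most `α / 2 ^ k`. The round budgets do not
depend on the sampled directions, so the bound on the number of queries is deterministic.
-/

/-! ### The uniform distribution on a sphere -/

open scoped Pointwise in
/-- The uniform distribution on the sphere is the law of the radial projection of a uniformly
distributed point of the unit ball. -/
lemma uniformSphere_eq_map_ball {d : ℕ} (hd : 1 ≤ d) (r : ℝ) :
    uniformSphere d r = ((volume : Measure (Pt d)) (Metric.ball 0 1))⁻¹ •
      ((volume : Measure (Pt d)).restrict (Metric.ball 0 1)).map
        (fun x => (r * ‖x‖⁻¹) • x) := by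
  have : NeZero d := ⟨by omega⟩
  have hmeas : Measurable (fun x : Pt d => (r * ‖x‖⁻¹) • x) := by fun_prop
  have hmeas' : Measurable (fun x : Metric.sphere (0 : Pt d) 1 => r • (x : Pt d)) := by fun_prop
  ext A hA
  rw [uniformSphere, Measure.map_apply hmeas' hA, Measure.smul_apply, Measure.smul_apply,
    Measure.map_apply hmeas hA, Measure.restrict_apply (hmeas hA), Measure.toSphere_apply_univ,
    Measure.toSphere_apply' _ (hmeas' hA)]
  have hset : volume (Set.Ioo (0 : ℝ) 1 •
        ((↑) '' ((fun x : Metric.sphere (0 : Pt d) 1 => r • (x : Pt d)) ⁻¹' A) : Set (Pt d))) =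
      volume ((fun x : Pt d => (r * ‖x‖⁻¹) • x) ⁻¹' A ∩ Metric.ball 0 1) := by
    rw [← measure_sdiff_null (measure_singleton (0 : Pt d))
      (s := (fun x : Pt d => (r * ‖x‖⁻¹) • x) ⁻¹' A ∩ Metric.ball 0 1)]
    congr 1
    ext x
    simp only [Set.mem_smul, Set.mem_image, Set.mem_preimage, Set.mem_sdiff, Set.mem_inter_iff,
      Metric.mem_ball, dist_zero_right, Set.mem_singleton_iff, Set.mem_Ioo]
    constructor
    · rintro ⟨c, ⟨hc0, hc1⟩, y, ⟨z, hz, rfl⟩, rfl⟩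
      have hz1 : ‖(z : Pt d)‖ = 1 := by simp
      have hn : ‖c • (z : Pt d)‖ = c := by rw [norm_smul, hz1, Real.norm_of_nonneg hc0.le, mul_one]
      refine ⟨⟨?_, by rw [hn]; exact hc1⟩, ?_⟩
      · rw [hn, smul_smul, mul_assoc, inv_mul_cancel₀ hc0.ne', mul_one]; exact hz
      · intro h0
        rw [h0, norm_zero] at hn
        exact hc0.ne hn
    · rintro ⟨⟨hxA, hx1⟩, hx0⟩
      have hpos : 0 < ‖x‖ := norm_pos_iff.2 hx0
      refine ⟨‖x‖, ⟨hpos, hx1⟩, ‖x‖⁻¹ • x, ⟨⟨‖x‖⁻¹ • x, ?_⟩, ?_, rfl⟩, ?_⟩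
      · simp [norm_smul, hpos.ne']
      · simpa [smul_smul] using hxA
      · rw [smul_smul, mul_inv_cancel₀ hpos.ne', one_smul]
  rw [hset]
  have hd0 : ((Module.finrank ℝ (Pt d) : ℕ) : ENNReal) ≠ 0 := by
    simp [NeZero.ne d]
  rw [smul_eq_mul, smul_eq_mul, ENNReal.mul_inv (Or.inl hd0)
    (Or.inr (Metric.measure_ball_pos _ _ one_pos).ne'),
    mul_comm (_ : ENNReal)⁻¹, mul_assoc, ← mul_assoc _ _ (volume _),
    ENNReal.inv_mul_cancel hd0 (ENNReal.natCast_ne_top _), one_mul]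

lemma isProbabilityMeasure_uniformSphere {d : ℕ} (hd : 1 ≤ d) (r : ℝ) :
    IsProbabilityMeasure (uniformSphere d r) := by
  have : NeZero d := ⟨by omega⟩
  constructor
  rw [uniformSphere_eq_map_ball hd, Measure.smul_apply, Measure.map_apply (by fun_prop) .univ]
  simp only [Set.preimage_univ, Measure.restrict_apply_univ, smul_eq_mul]
  exact ENNReal.inv_mul_cancel (Metric.measure_ball_pos _ _ one_pos).ne' measure_ball_lt_top.ne

lemma uniformSphere_map_isometry {d : ℕ} (hd : 1 ≤ d) (r : ℝ) (L : Pt d ≃ₗᵢ[ℝ] Pt d) :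
    (uniformSphere d r).map L = uniformSphere d r := by
  have hL : Measurable (L : Pt d → Pt d) := L.continuous.measurable
  have hmeas : Measurable (fun x : Pt d => (r * ‖x‖⁻¹) • x) := by fun_prop
  rw [uniformSphere_eq_map_ball hd, Measure.map_smul, Measure.map_map hL hmeas]
  have hcomp : (L : Pt d → Pt d) ∘ (fun x : Pt d => (r * ‖x‖⁻¹) • x) =
      (fun x : Pt d => (r * ‖x‖⁻¹) • x) ∘ L := by
    ext1 x; simp
  have hball : (L : Pt d → Pt d) ⁻¹' Metric.ball 0 1 = Metric.ball 0 1 := by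
    ext x; simp
  have hres := (L.measurePreserving.restrict_preimage
    (measurableSet_ball (x := (0 : Pt d)) (ε := 1))).map_eq
  rw [hball] at hres
  rw [hcomp, ← Measure.map_map hmeas hL, hres]

lemma ae_norm_uniformSphere (d : ℕ) {r : ℝ} (hr : 0 ≤ r) :
    ∀ᵐ x ∂(uniformSphere d r), ‖x‖ = r := by
  rw [uniformSphere, ae_map_iff (by fun_prop) (measurableSet_eq_fun (by fun_prop) (by fun_prop))]
  refine Filter.Eventually.of_forall fun x => ?_
  have hx1 : ‖(x : Pt d)‖ = 1 := by simp
  rw [norm_smul, hx1, Real.norm_of_nonneg hr, mul_one]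

open scoped Pointwise in
/-- A thin slab of the unit ball contains at most the proportion `12 δ √(d + 1)` of its volume:
shrunk by the factor `d / (d + 1)`, which costs a factor at most `3` in volume, the slab has
about `1 / (4 δ √(d + 1))` disjoint translates inside the ball. -/
lemma volume_slab_le {d : ℕ} (hd : 1 ≤ d) {g : Pt d} (hg : ‖g‖ = 1) {δ : ℝ} (hδ : 0 < δ) :
    (volume : Measure (Pt d)).real ({x | |inner ℝ x g| ≤ δ} ∩ Metric.ball 0 1) ≤
      12 * δ * Real.sqrt (d + 1) * (volume : Measure (Pt d)).real (Metric.ball 0 1) := by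
  set V := (volume : Measure (Pt d)).real (Metric.ball 0 1) with hV
  set S : Set (Pt d) := {x | |inner ℝ x g| ≤ δ} ∩ Metric.ball 0 1 with hS
  have hSV : (volume : Measure (Pt d)).real S ≤ V :=
    measureReal_mono Set.inter_subset_right measure_ball_lt_top.ne
  have hV0 : 0 ≤ V := measureReal_nonneg
  have hd' : (1 : ℝ) ≤ d := by exact_mod_cast hd
  set q := Real.sqrt (d + 1) with hq
  have hq2 : q ^ 2 = d + 1 := Real.sq_sqrt (by positivity)
  have hqpos : 0 < q := Real.sqrt_pos.2 (by positivity)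
  rcases le_or_gt (1 / (2 * q)) δ with hbig | hsmall
  · refine hSV.trans (le_mul_of_one_le_left hV0 ?_)
    rw [div_le_iff₀ (by positivity)] at hbig
    nlinarith
  set κ : ℝ := d / (d + 1) with hκ
  have hκ0 : 0 < κ := by positivity
  have hκ1 : κ < 1 := by rw [hκ, div_lt_one (by positivity)]; linarith
  set N : ℕ := ⌊(1 / (2 * q)) / (2 * δ)⌋₊ + 1 with hN
  have hNge : (1 / (2 * q)) / (2 * δ) ≤ N := by
    rw [hN]; push_cast; exact (Nat.lt_floor_add_one _).le
  let A : ℕ → Set (Pt d) := fun j => (fun x => (2 * δ * j) • g + κ • x) '' S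
  have hSmeas : MeasurableSet S :=
    (measurableSet_le (by fun_prop) (by fun_prop)).inter measurableSet_ball
  have hAeq : ∀ j, A j = (fun x => (2 * δ * j) • g + x) '' (κ • S) := by
    intro j; simp only [A, ← Set.image_smul, Set.image_image]
  have hAmeas : ∀ j, MeasurableSet (A j) := by
    intro j
    rw [hAeq]
    exact (MeasurableEquiv.addLeft ((2 * δ * j) • g)).measurableSet_image.2
      (hSmeas.const_smul₀ κ)
  have hAvol : ∀ j, (volume : Measure (Pt d)).real (A j) = κ ^ d * volume.real S := by
    intro j
    rw [hAeq, measureReal_def, Set.image_add_left, measure_preimage_add, Measure.addHaar_smul,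
      ENNReal.toReal_mul, measureReal_def]
    simp [abs_of_pos hκ0, (pow_pos hκ0 d).le]
  have hinner : ∀ j, ∀ y ∈ A j, |inner ℝ y g - 2 * δ * j| < δ := by
    rintro j y ⟨x, hx, rfl⟩
    have hx1 : |inner ℝ x g| ≤ δ := hx.1
    simp only [inner_add_left, inner_smul_left, real_inner_self_eq_norm_sq, hg]
    simp only [conj_trivial, one_pow, mul_one, add_sub_cancel_left, abs_mul, abs_of_pos hκ0]
    nlinarith [abs_nonneg (inner ℝ x g)]
  have hdisj : Pairwise (Function.onFun Disjoint A) := by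
    intro i j hij
    rw [Function.onFun, Set.disjoint_left]
    intro y hi hj
    have h1 := abs_lt.1 (hinner i y hi)
    have h2 := abs_lt.1 (hinner j y hj)
    apply hij
    have h3 : (i : ℝ) < j + 1 := by
      by_contra h
      push Not at h
      nlinarith
    have h4 : (j : ℝ) < i + 1 := by
      by_contra h
      push Not at h
      nlinarith
    have h3' : i < j + 1 := by exact_mod_cast h3
    have h4' : j < i + 1 := by exact_mod_cast h4
    omega
  have hsub : (⋃ j ∈ Finset.range N, A j) ⊆ Metric.ball (0 : Pt d) 1 := by
    intro y hy
    simp only [Set.mem_iUnion, Finset.mem_range] at hy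
    obtain ⟨j, hj, x, ⟨hx1, hx2⟩, rfl⟩ := hy
    simp only [Set.mem_ofPred_eq] at hx1
    rw [mem_ball_zero_iff] at hx2 ⊢
    set s : ℝ := 2 * δ * j with hs
    have hs0 : 0 ≤ s := by positivity
    have hs1 : s ≤ 1 / (2 * q) := by
      have hjle : (j : ℝ) ≤ (1 / (2 * q)) / (2 * δ) := by
        have : j ≤ ⌊(1 / (2 * q)) / (2 * δ)⌋₊ := by omega
        exact (Nat.le_floor_iff (by positivity)).1 this
      rw [le_div_iff₀ (by positivity)] at hjle
      linarith
    have hnsq : ‖s • g + κ • x‖ ^ 2 = s ^ 2 + 2 * (s * κ * inner ℝ x g) + κ ^ 2 * ‖x‖ ^ 2 := by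
      rw [norm_add_sq_real, norm_smul, norm_smul, hg, inner_smul_left, inner_smul_right,
        real_inner_comm]
      simp [mul_pow]; ring
    have hle1 : s * κ * inner ℝ x g ≤ s * δ := by
      have h1 : κ * inner ℝ x g ≤ δ := by
        nlinarith [le_abs_self (inner ℝ x g), abs_nonneg (inner ℝ x g)]
      calc s * κ * inner ℝ x g = s * (κ * inner ℝ x g) := by ring
        _ ≤ s * δ := mul_le_mul_of_nonneg_left h1 hs0
    have hx3 : κ ^ 2 * ‖x‖ ^ 2 < κ ^ 2 := by
      have : ‖x‖ ^ 2 < 1 := by nlinarith [norm_nonneg x]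
      nlinarith [pow_pos hκ0 2]
    have hκ2 : κ ^ 2 + 1 / (d + 1) ≤ 1 := by
      rw [hκ, div_pow, ← sub_nonneg]
      have : 1 - ((d : ℝ) ^ 2 / (d + 1) ^ 2 + 1 / (d + 1)) = d / (d + 1) ^ 2 := by
        field_simp; ring
      rw [this]; positivity
    have hs2 : s * δ ≤ (1 / (2 * q)) * (1 / (2 * q)) :=
      mul_le_mul hs1 hsmall.le hδ.le (by positivity)
    have hs3 : s ^ 2 ≤ (1 / (2 * q)) * (1 / (2 * q)) := by rw [sq]; gcongr
    have hq4 : (1 / (2 * q)) * (1 / (2 * q)) = (1 / 4) * (1 / (d + 1)) := by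
      rw [← hq2]; field_simp; norm_num
    have hpos : 0 < 1 / ((d : ℝ) + 1) := by positivity
    have : ‖s • g + κ • x‖ ^ 2 < 1 := by rw [hnsq]; linarith
    nlinarith [norm_nonneg (s • g + κ • x)]
  have hsum : (N : ℝ) * (κ ^ d * volume.real S) ≤ V := by
    have h1 := measureReal_mono (μ := (volume : Measure (Pt d))) hsub measure_ball_lt_top.ne
    rw [measureReal_biUnion_finset (fun i _ j _ hij => hdisj hij) (fun j _ => hAmeas j)
      (fun j _ => ne_top_of_le_ne_top (measure_ball_lt_top (μ := (volume : Measure (Pt d)))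
        (x := 0) (r := 1)).ne (measure_mono
        ((Set.subset_biUnion_of_mem (u := A) (Finset.mem_coe.2 ‹_›)).trans hsub)))] at h1
    simpa [hAvol] using h1
  have hκd : 1 / 3 ≤ κ ^ d := by
    have h1 : (1 + 1 / (d : ℝ)) ^ d ≤ 3 := by
      have h2 : 1 + 1 / (d : ℝ) ≤ Real.exp (1 / d) := by
        linarith [Real.add_one_le_exp (1 / (d : ℝ))]
      calc (1 + 1 / (d : ℝ)) ^ d ≤ Real.exp (1 / d) ^ d := by gcongr
        _ = Real.exp 1 := by
          rw [← Real.exp_nat_mul]; congr 1; field_simp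
        _ ≤ 3 := by linarith [Real.exp_one_lt_d9]
    have h3 : κ ^ d = 1 / (1 + 1 / (d : ℝ)) ^ d := by
      rw [hκ, ← one_div_pow]; congr 1; field_simp
    rw [h3]
    exact one_div_le_one_div_of_le (by positivity) h1
  have hS0 : 0 ≤ (volume : Measure (Pt d)).real S := measureReal_nonneg
  have hchain : (1 / (2 * q)) / (2 * δ) * ((1 / 3) * (volume : Measure (Pt d)).real S) ≤ V :=
    (mul_le_mul hNge (mul_le_mul_of_nonneg_right hκd hS0) (by positivity) (by positivity)).trans hsum
  have hid : (1 / (2 * q)) / (2 * δ) * ((1 / 3) * (volume : Measure (Pt d)).real S) =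
      (volume : Measure (Pt d)).real S / (12 * δ * q) := by field_simp; ring
  rw [hid, div_le_iff₀ (by positivity)] at hchain
  linarith

/-- Small-ball estimate: the component of a uniform point of the sphere along a fixed unit vector
is at most `δ r` in absolute value with probability `O(√d δ)`. -/
lemma uniformSphere_slab_le {d : ℕ} (hd : 1 ≤ d) {r : ℝ} (hr : 0 < r) {g : Pt d} (hg : ‖g‖ = 1)
    {δ : ℝ} (hδ : 0 < δ) :
    (uniformSphere d r).real {x | |inner ℝ x g| ≤ r * δ} ≤ 17 * Real.sqrt d * δ := by
  have : NeZero d := ⟨by omega⟩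
  have hmeas : Measurable (fun x : Pt d => (r * ‖x‖⁻¹) • x) := by fun_prop
  have hset : MeasurableSet {x : Pt d | |inner ℝ x g| ≤ r * δ} :=
    measurableSet_le (by fun_prop) (by fun_prop)
  have hVpos : 0 < (volume : Measure (Pt d)).real (Metric.ball 0 1) :=
    ENNReal.toReal_pos (Metric.measure_ball_pos _ _ one_pos).ne' measure_ball_lt_top.ne
  have h1 : (uniformSphere d r).real {x | |inner ℝ x g| ≤ r * δ} ≤
      ((volume : Measure (Pt d)).real (Metric.ball 0 1))⁻¹ *
        (volume : Measure (Pt d)).real ({x | |inner ℝ x g| ≤ δ} ∩ Metric.ball 0 1) := by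
    rw [uniformSphere_eq_map_ball hd, measureReal_def, Measure.smul_apply,
      Measure.map_apply hmeas hset, Measure.restrict_apply (hmeas hset), smul_eq_mul,
      ENNReal.toReal_mul, ENNReal.toReal_inv]
    refine mul_le_mul_of_nonneg_left ?_ (by positivity)
    refine measureReal_mono ?_ (ne_top_of_le_ne_top measure_ball_lt_top.ne
      (measure_mono Set.inter_subset_right))
    rintro x ⟨hx1, hx2⟩
    refine ⟨?_, hx2⟩
    rw [mem_ball_zero_iff] at hx2
    simp only [Set.mem_preimage, Set.mem_ofPred_eq, inner_smul_left, conj_trivial, abs_mul,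
      abs_of_pos hr, abs_inv, abs_norm, mul_assoc] at hx1 ⊢
    have hx3 := le_of_mul_le_mul_left hx1 hr
    rcases eq_or_ne x 0 with rfl | hx0
    · simp [hδ.le]
    · have hpos : 0 < ‖x‖ := norm_pos_iff.2 hx0
      rw [inv_mul_le_iff₀ hpos] at hx3
      nlinarith
  refine h1.trans ?_
  rw [inv_mul_le_iff₀ hVpos]
  refine (volume_slab_le hd hg hδ).trans ?_
  have hd' : (1 : ℝ) ≤ d := by exact_mod_cast hd
  have h2 : 12 * Real.sqrt (d + 1) ≤ 17 * Real.sqrt d := by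
    rw [← abs_of_nonneg (by positivity : 0 ≤ 12 * Real.sqrt ((d : ℝ) + 1)),
      ← abs_of_nonneg (by positivity : 0 ≤ 17 * Real.sqrt (d : ℝ)), ← sq_le_sq, mul_pow, mul_pow,
      Real.sq_sqrt (by positivity), Real.sq_sqrt (by positivity)]
    linarith
  nlinarith [mul_le_mul_of_nonneg_right h2 (mul_nonneg hδ.le hVpos.le)]

/-! ### Moments of the uniform distribution on a sphere -/

/-- The sign of a real number, with `sign 0 = 1`. -/
noncomputable def signOne (t : ℝ) : ℝ := if 0 ≤ t then 1 else -1

lemma signOne_mul_self (t : ℝ) : signOne t * t = |t| := by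
  unfold signOne; split_ifs with h
  · rw [abs_of_nonneg h, one_mul]
  · rw [abs_of_neg (not_le.1 h), neg_one_mul]

lemma abs_signOne (t : ℝ) : |signOne t| = 1 := by
  unfold signOne; split_ifs <;> simp

lemma signOne_sq (t : ℝ) : signOne t ^ 2 = 1 := by
  rw [← sq_abs, abs_signOne, one_pow]

@[fun_prop]
lemma measurable_signOne : Measurable signOne :=
  Measurable.ite measurableSet_Ici measurable_const measurable_const

lemma integrable_uniformSphere {d : ℕ} (hd : 1 ≤ d) {r : ℝ} (hr : 0 ≤ r) {φ : Pt d → ℝ}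
    (hφ : Measurable φ) (C : ℝ) (hC : ∀ x, ‖x‖ = r → |φ x| ≤ C) :
    Integrable φ (uniformSphere d r) := by
  have := isProbabilityMeasure_uniformSphere hd r
  refine Integrable.of_bound hφ.aestronglyMeasurable C ?_
  filter_upwards [ae_norm_uniformSphere d hr] with x hx using hC x hx

lemma abs_inner_le_of_norm_eq {d : ℕ} {r : ℝ} {x y : Pt d} (hx : ‖x‖ = r) :
    |inner ℝ x y| ≤ r * ‖y‖ := hx ▸ abs_real_inner_le_norm x y

lemma integrable_inner_pow_uniformSphere {d : ℕ} (hd : 1 ≤ d) {r : ℝ} (hr : 0 ≤ r) (y : Pt d)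
    (k : ℕ) : Integrable (fun x => (inner ℝ x y) ^ k) (uniformSphere d r) := by
  refine integrable_uniformSphere hd hr (by fun_prop) ((r * ‖y‖) ^ k) fun x hx => ?_
  rw [abs_pow]
  gcongr
  exact abs_inner_le_of_norm_eq hx

lemma integral_uniformSphere_comp_isometry {d : ℕ} (hd : 1 ≤ d) (r : ℝ) (L : Pt d ≃ₗᵢ[ℝ] Pt d)
    (φ : Pt d → ℝ) : ∫ x, φ (L x) ∂(uniformSphere d r) = ∫ x, φ x ∂(uniformSphere d r) := by
  conv_rhs => rw [← uniformSphere_map_isometry hd r L]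
  exact (L.toHomeomorph.measurableEmbedding.integral_map φ).symm

lemma integral_comp_inner_uniformSphere_congr {d : ℕ} (hd : 1 ≤ d) (r : ℝ) {y z : Pt d}
    (hyz : ‖y‖ = ‖z‖) (φ : ℝ → ℝ) :
    ∫ x, φ (inner ℝ x y) ∂(uniformSphere d r) = ∫ x, φ (inner ℝ x z) ∂(uniformSphere d r) := by
  set L : Pt d ≃ₗᵢ[ℝ] Pt d := (Submodule.span ℝ {y - z})ᗮ.reflection
  have hL : L y = z := Submodule.reflection_sub hyz
  rw [← integral_uniformSphere_comp_isometry hd r L (fun x => φ (inner ℝ x z))]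
  congr 1; ext x
  rw [← hL, L.inner_map_map]

lemma integral_inner_sq_uniformSphere {d : ℕ} (hd : 1 ≤ d) {r : ℝ} (hr : 0 ≤ r) (y : Pt d) :
    ∫ x, (inner ℝ x y) ^ 2 ∂(uniformSphere d r) = r ^ 2 * ‖y‖ ^ 2 / d := by
  have := isProbabilityMeasure_uniformSphere hd r
  have hd0 : (d : ℝ) ≠ 0 := by positivity
  set b := EuclideanSpace.basisFun (Fin d) ℝ
  have h1 : ∀ i, ∫ x, (inner ℝ x y) ^ 2 ∂(uniformSphere d r) =
      ∫ x, (inner ℝ x (‖y‖ • b i)) ^ 2 ∂(uniformSphere d r) := fun i =>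
    integral_comp_inner_uniformSphere_congr hd r (by simp [norm_smul]) (fun t => t ^ 2)
  have h2 : ∑ i, ∫ x, (inner ℝ x (‖y‖ • b i)) ^ 2 ∂(uniformSphere d r) = r ^ 2 * ‖y‖ ^ 2 := by
    rw [← integral_finsetSum _
      (fun i _ => integrable_inner_pow_uniformSphere hd hr (‖y‖ • b i) 2)]
    have h3 : ∫ x, ∑ i, (inner ℝ x (‖y‖ • b i)) ^ 2 ∂(uniformSphere d r) =
        ∫ x, r ^ 2 * ‖y‖ ^ 2 ∂(uniformSphere d r) := by
      apply integral_congr_ae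
      filter_upwards [ae_norm_uniformSphere d hr] with x hx
      have := b.sum_sq_norm_inner_left x
      simp only [Real.norm_eq_abs, sq_abs, hx] at this
      simp only [inner_smul_right, mul_pow, ← Finset.mul_sum, this]
      ring
    rw [h3]; simp
  rw [Finset.sum_congr rfl (fun i _ => (h1 i).symm)] at h2
  simp only [Finset.sum_const, Finset.card_univ, Fintype.card_fin, nsmul_eq_mul] at h2
  rw [eq_div_iff hd0, ← h2]; ring

/-- The fourth moment of a coordinate is `3 r ^ 4 / (d (d + 2))`: rotating by an eighth of a turn
in a coordinate plane gives the mixed moments, and the squared coordinates add up to `r ^ 2`. -/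
lemma integral_inner_pow_four_uniformSphere_le {d : ℕ} (hd : 1 ≤ d) {r : ℝ} (hr : 0 ≤ r)
    {g : Pt d} (hg : ‖g‖ = 1) :
    ∫ x, (inner ℝ x g) ^ 4 ∂(uniformSphere d r) ≤ 3 * r ^ 4 / d ^ 2 := by
  have := isProbabilityMeasure_uniformSphere hd r
  have hd' : (1 : ℝ) ≤ d := by exact_mod_cast hd
  set ν := uniformSphere d r
  set b := EuclideanSpace.basisFun (Fin d) ℝ
  set A := ∫ x, (inner ℝ x g) ^ 4 ∂ν with hA
  have hA0 : 0 ≤ A := integral_nonneg fun x => by positivity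
  have hAi : ∀ i, ∫ x, (inner ℝ x (b i)) ^ 4 ∂ν = A := fun i =>
    integral_comp_inner_uniformSphere_congr hd r (by simp [hg]) (fun t => t ^ 4)
  have hInt2 : ∀ i j, Integrable (fun x => (inner ℝ x (b i)) ^ 2 * (inner ℝ x (b j)) ^ 2) ν := by
    intro i j
    refine integrable_uniformSphere hd hr (by fun_prop) (r ^ 2 * r ^ 2) fun x hx => ?_
    rw [abs_mul, abs_pow, abs_pow]
    have h1 : ∀ i, |inner ℝ x (b i)| ≤ r := fun i => by
      simpa using abs_inner_le_of_norm_eq (y := b i) hx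
    gcongr
    · exact h1 i
    · exact h1 j
  have hB : ∀ i j, i ≠ j →
      ∫ x, (inner ℝ x (b i)) ^ 2 * (inner ℝ x (b j)) ^ 2 ∂ν = A / 3 := by
    intro i j hij
    have horth : inner ℝ (b i) (b j) = (0 : ℝ) := b.orthonormal.2 hij
    have hn : ‖Real.sqrt 2 • b i‖ = Real.sqrt 2 := by simp [norm_smul]
    have hp : ‖b i + b j‖ = Real.sqrt 2 := by
      rw [← Real.sqrt_sq (norm_nonneg _), norm_add_sq_real, horth]; simp; norm_num
    have hm : ‖b i - b j‖ = Real.sqrt 2 := by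
      rw [← Real.sqrt_sq (norm_nonneg _), norm_sub_sq_real, horth]; simp; norm_num
    have h4 : ∫ x, (inner ℝ x (Real.sqrt 2 • b i)) ^ 4 ∂ν = 4 * A := by
      simp only [inner_smul_right, mul_pow]
      rw [integral_const_mul, hAi]
      have : Real.sqrt 2 ^ 4 = 4 := by
        rw [show 4 = 2 * 2 from rfl, pow_mul, Real.sq_sqrt (by norm_num)]; norm_num
      rw [this]
    have hp4 : ∫ x, (inner ℝ x (b i + b j)) ^ 4 ∂ν = 4 * A := by
      rw [← h4]
      exact integral_comp_inner_uniformSphere_congr hd r (hp.trans hn.symm) (fun t => t ^ 4)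
    have hm4 : ∫ x, (inner ℝ x (b i - b j)) ^ 4 ∂ν = 4 * A := by
      rw [← h4]
      exact integral_comp_inner_uniformSphere_congr hd r (hm.trans hn.symm) (fun t => t ^ 4)
    have hsum : ∫ x, ((inner ℝ x (b i + b j)) ^ 4 + (inner ℝ x (b i - b j)) ^ 4) ∂ν =
        ∫ x, (2 * (inner ℝ x (b i)) ^ 4 + 2 * (inner ℝ x (b j)) ^ 4 +
          12 * ((inner ℝ x (b i)) ^ 2 * (inner ℝ x (b j)) ^ 2)) ∂ν := by
      congr 1; ext x
      rw [inner_add_right, inner_sub_right]; ring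
    have hi := integrable_inner_pow_uniformSphere hd hr (b i) 4
    have hj := integrable_inner_pow_uniformSphere hd hr (b j) 4
    have hij2 : Integrable (fun x => 2 * (inner ℝ x (b i)) ^ 4 + 2 * (inner ℝ x (b j)) ^ 4) ν :=
      (hi.const_mul 2).add (hj.const_mul 2)
    rw [integral_add (integrable_inner_pow_uniformSphere hd hr _ 4)
      (integrable_inner_pow_uniformSphere hd hr _ 4), hp4, hm4,
      integral_add hij2 ((hInt2 i j).const_mul 12),
      integral_add (hi.const_mul 2) (hj.const_mul 2), integral_const_mul, integral_const_mul,
      integral_const_mul, hAi, hAi] at hsum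
    linarith
  have htot : ∑ i, ∑ j, ∫ x, (inner ℝ x (b i)) ^ 2 * (inner ℝ x (b j)) ^ 2 ∂ν = r ^ 4 := by
    rw [Finset.sum_congr rfl fun i _ => (integral_finsetSum _ fun j _ => hInt2 i j).symm,
      ← integral_finsetSum _ fun i _ => integrable_finsetSum _ fun j _ => hInt2 i j]
    have h3 : ∫ x, ∑ i, ∑ j, (inner ℝ x (b i)) ^ 2 * (inner ℝ x (b j)) ^ 2 ∂ν =
        ∫ x, r ^ 4 ∂ν := by
      apply integral_congr_ae
      filter_upwards [ae_norm_uniformSphere d hr] with x hx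
      have := b.sum_sq_norm_inner_left x
      simp only [Real.norm_eq_abs, sq_abs, hx] at this
      simp only [← Finset.mul_sum, ← Finset.sum_mul, this]
      ring
    rw [h3]; simp
  have hrow : ∀ i, ∑ j, ∫ x, (inner ℝ x (b i)) ^ 2 * (inner ℝ x (b j)) ^ 2 ∂ν =
      A + (d - 1) * (A / 3) := by
    intro i
    rw [← Finset.add_sum_erase _ _ (Finset.mem_univ i)]
    rw [Finset.sum_congr rfl fun j hj => hB i j (Finset.ne_of_mem_erase hj).symm]
    have : ∫ x, (inner ℝ x (b i)) ^ 2 * (inner ℝ x (b i)) ^ 2 ∂ν = A := by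
      rw [← hAi i]; congr 1; ext x; ring
    rw [this]
    simp [Finset.card_erase_of_mem, Nat.cast_sub hd]
  simp only [hrow, Finset.sum_const, Finset.card_univ, Fintype.card_fin, nsmul_eq_mul] at htot
  rw [le_div_iff₀ (by positivity)]
  nlinarith

/-- The mean absolute value of a coordinate is at least `9 r / (16 √d)`: the polynomial
`(3 λ t ^ 2 - λ ^ 3 t ^ 4) / 2` with `λ = √d / (2 r)` is a minorant of `|t|`. -/
lemma le_integral_abs_inner_uniformSphere {d : ℕ} (hd : 1 ≤ d) {r : ℝ} (hr : 0 < r)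
    {g : Pt d} (hg : ‖g‖ = 1) :
    9 / 16 * (r / Real.sqrt d) ≤ ∫ x, |inner ℝ x g| ∂(uniformSphere d r) := by
  have := isProbabilityMeasure_uniformSphere hd r
  have hd' : (1 : ℝ) ≤ d := by exact_mod_cast hd
  set q := Real.sqrt d with hq
  have hq0 : 0 < q := Real.sqrt_pos.2 (by positivity)
  have hq2 : (d : ℝ) = q ^ 2 := (Real.sq_sqrt (by positivity)).symm
  set l : ℝ := q / (2 * r) with hl
  have hl0 : 0 < l := by positivity
  have h2 := integrable_inner_pow_uniformSphere hd hr.le g 2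
  have h4 := integrable_inner_pow_uniformSphere hd hr.le g 4
  have h1 : Integrable (fun x => |inner ℝ x g|) (uniformSphere d r) := by
    simpa using (integrable_inner_pow_uniformSphere hd hr.le g 1).abs
  have hmono : ∫ x, (3 * l / 2 * (inner ℝ x g) ^ 2 - l ^ 3 / 2 * (inner ℝ x g) ^ 4)
      ∂(uniformSphere d r) ≤ ∫ x, |inner ℝ x g| ∂(uniformSphere d r) := by
    refine integral_mono ((h2.const_mul _).sub (h4.const_mul _)) h1 fun x => ?_
    simp only
    set t := |inner ℝ x g| with ht
    have ht0 : 0 ≤ t := abs_nonneg _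
    rw [← sq_abs (inner ℝ x g), ← ht,
      show (inner ℝ x g) ^ 4 = t ^ 4 by rw [ht, ← abs_pow, abs_of_nonneg (by positivity)]]
    have hp : 0 ≤ (l * t - 1) ^ 2 * (l * t + 2) := by positivity
    nlinarith [mul_nonneg ht0 hp]
  rw [integral_sub (h2.const_mul _) (h4.const_mul _), integral_const_mul, integral_const_mul,
    integral_inner_sq_uniformSphere hd hr.le, hg] at hmono
  refine le_trans ?_ hmono
  have hA := integral_inner_pow_four_uniformSphere_le hd hr.le hg
  have h5 := mul_le_mul_of_nonneg_left hA (by positivity : 0 ≤ l ^ 3 / 2)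
  have h6 : 3 * l / 2 * (r ^ 2 * 1 ^ 2 / d) - l ^ 3 / 2 * (3 * r ^ 4 / d ^ 2) =
      9 / 16 * (r / q) := by
    rw [hl, hq2]; field_simp; norm_num
  linarith

lemma integral_abs_inner_uniformSphere_le {d : ℕ} (hd : 1 ≤ d) {r : ℝ} (hr : 0 < r)
    {g : Pt d} (hg : ‖g‖ = 1) :
    ∫ x, |inner ℝ x g| ∂(uniformSphere d r) ≤ r / Real.sqrt d := by
  have := isProbabilityMeasure_uniformSphere hd r
  have hd' : (1 : ℝ) ≤ d := by exact_mod_cast hd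
  set q := Real.sqrt d with hq
  have hq0 : 0 < q := Real.sqrt_pos.2 (by positivity)
  have hq2 : (d : ℝ) = q ^ 2 := (Real.sq_sqrt (by positivity)).symm
  have h2 := integrable_inner_pow_uniformSphere hd hr.le g 2
  have h1 : Integrable (fun x => |inner ℝ x g|) (uniformSphere d r) := by
    simpa using (integrable_inner_pow_uniformSphere hd hr.le g 1).abs
  have hmono : ∫ x, |inner ℝ x g| ∂(uniformSphere d r) ≤
      ∫ x, (q / (2 * r) * (inner ℝ x g) ^ 2 + r / (2 * q)) ∂(uniformSphere d r) := by
    refine integral_mono h1 ((h2.const_mul _).add (integrable_const _)) fun x => ?_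
    simp only
    set t := |inner ℝ x g| with ht
    rw [← sq_abs (inner ℝ x g), ← ht]
    have hp : 0 ≤ (q * t - r) ^ 2 / (2 * r * q) := by positivity
    have : (q * t - r) ^ 2 / (2 * r * q) = q / (2 * r) * t ^ 2 + r / (2 * q) - t := by
      field_simp; ring
    linarith
  rw [integral_add (h2.const_mul _) (integrable_const _), integral_const_mul,
    integral_inner_sq_uniformSphere hd hr.le, hg] at hmono
  refine hmono.trans (le_of_eq ?_)
  simp only [integral_const, probReal_univ, smul_eq_mul, hq2]
  field_simp; norm_num

/-- Reflecting across the line through `g` shows that the mean of `sign ⟨x, g⟩ x` is a multiple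
of `g`. -/
lemma integral_signOne_mul_inner_uniformSphere {d : ℕ} (hd : 1 ≤ d) {r : ℝ} (hr : 0 ≤ r)
    {g : Pt d} (hg : ‖g‖ = 1) (y : Pt d) :
    ∫ x, signOne (inner ℝ x g) * inner ℝ x y ∂(uniformSphere d r) =
      (∫ x, |inner ℝ x g| ∂(uniformSphere d r)) * inner ℝ g y := by
  have := isProbabilityMeasure_uniformSphere hd r
  set L : Pt d ≃ₗᵢ[ℝ] Pt d := (Submodule.span ℝ {g}).reflection
  have hLg : L g = g :=
    Submodule.reflection_mem_subspace_eq_self (Submodule.mem_span_singleton_self g)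
  have hLx : ∀ x, L x = (2 * inner ℝ x g) • g - x := by
    intro x
    simp only [L]
    rw [Submodule.reflection_apply, Submodule.starProjection_unit_singleton ℝ hg, real_inner_comm,
      two_smul ℕ, ← add_smul, two_mul]
  have hint : Integrable (fun x => signOne (inner ℝ x g) * inner ℝ x y) (uniformSphere d r) := by
    refine integrable_uniformSphere hd hr (by fun_prop) (r * ‖y‖) fun x hx => ?_
    rw [abs_mul, abs_signOne, one_mul]
    exact abs_inner_le_of_norm_eq hx
  have h1 : Integrable (fun x => |inner ℝ x g|) (uniformSphere d r) := by
    simpa using (integrable_inner_pow_uniformSphere hd hr g 1).abs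
  have key := integral_uniformSphere_comp_isometry hd r L
    (fun x => signOne (inner ℝ x g) * inner ℝ x y)
  have hL' : ∀ x, signOne (inner ℝ (L x) g) * inner ℝ (L x) y =
      2 * inner ℝ g y * |inner ℝ x g| - signOne (inner ℝ x g) * inner ℝ x y := by
    intro x
    have : inner ℝ (L x) g = inner ℝ x g := by
      conv_lhs => rw [← hLg]
      exact L.inner_map_map x g
    rw [this, hLx, inner_sub_left, inner_smul_left, ← signOne_mul_self]
    simp only [conj_trivial]; ring
  simp only [hL'] at key
  rw [integral_sub (h1.const_mul _) hint, integral_const_mul] at key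
  linarith

/-! ### Sums of independent signed directions -/

lemma ProbabilityTheory.IndepFun.lintegral_comp_prodMk {Ω E F : Type*} [MeasurableSpace Ω]
    [MeasurableSpace E] [MeasurableSpace F] {P : Measure Ω} [IsProbabilityMeasure P]
    {X : Ω → E} {Y : Ω → F} (hXY : IndepFun X Y P) (hX : Measurable X) (hY : Measurable Y)
    {φ : E → F → ENNReal} (hφ : Measurable (Function.uncurry φ)) :
    ∫⁻ ω, φ (X ω) (Y ω) ∂P = ∫⁻ ω, ∫⁻ ω', φ (X ω) (Y ω') ∂P ∂P := by
  have : IsProbabilityMeasure (P.map X) := Measure.isProbabilityMeasure_map hX.aemeasurable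
  have : IsProbabilityMeasure (P.map Y) := Measure.isProbabilityMeasure_map hY.aemeasurable
  have h1 : ∫⁻ ω, φ (X ω) (Y ω) ∂P =
      ∫⁻ z, Function.uncurry φ z ∂(P.map fun ω => (X ω, Y ω)) := by
    rw [lintegral_map hφ (hX.prodMk hY)]; rfl
  rw [h1, (indepFun_iff_map_prod_eq_prod_map_map hX.aemeasurable hY.aemeasurable).1 hXY,
    lintegral_prod _ hφ.aemeasurable, lintegral_map hφ.lintegral_prod_right' hX]
  congr 1; ext ω
  exact lintegral_map (hφ.comp measurable_prodMk_left) hY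

lemma ProbabilityTheory.IndepFun.integral_comp_prodMk {Ω E F : Type*} [MeasurableSpace Ω]
    [MeasurableSpace E] [MeasurableSpace F] {P : Measure Ω} [IsProbabilityMeasure P]
    {X : Ω → E} {Y : Ω → F} (hXY : IndepFun X Y P) (hX : Measurable X) (hY : Measurable Y)
    {φ : E → F → ℝ} (hφ : Measurable (Function.uncurry φ))
    (hint : Integrable (fun ω => φ (X ω) (Y ω)) P) :
    ∫ ω, φ (X ω) (Y ω) ∂P = ∫ ω, ∫ ω', φ (X ω) (Y ω') ∂P ∂P := by
  have : IsProbabilityMeasure (P.map X) := Measure.isProbabilityMeasure_map hX.aemeasurable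
  have : IsProbabilityMeasure (P.map Y) := Measure.isProbabilityMeasure_map hY.aemeasurable
  have hmap := (indepFun_iff_map_prod_eq_prod_map_map hX.aemeasurable hY.aemeasurable).1 hXY
  have h1 : ∫ ω, φ (X ω) (Y ω) ∂P =
      ∫ z, Function.uncurry φ z ∂(P.map fun ω => (X ω, Y ω)) := by
    rw [integral_map (hX.prodMk hY).aemeasurable hφ.aestronglyMeasurable]; rfl
  have hint' : Integrable (Function.uncurry φ) ((P.map X).prod (P.map Y)) := by
    rw [← hmap, integrable_map_measure hφ.aestronglyMeasurable (hX.prodMk hY).aemeasurable]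
    exact hint
  rw [h1, hmap, integral_prod _ hint', integral_map hX.aemeasurable
    (hφ.stronglyMeasurable.integral_prod_right').aestronglyMeasurable]
  congr 1; ext ω
  exact integral_map hY.aemeasurable (hφ.comp measurable_prodMk_left).aestronglyMeasurable

/-- The direction `x` or `-x`, whichever makes an angle at most `π / 2` with `g`. -/
noncomputable def alignedDir {d : ℕ} (g x : Pt d) : Pt d := signOne (inner ℝ x g) • x

@[fun_prop]
lemma measurable_alignedDir {d : ℕ} (g : Pt d) : Measurable (alignedDir g) := by
  unfold alignedDir; fun_prop

lemma norm_alignedDir {d : ℕ} (g x : Pt d) : ‖alignedDir g x‖ = ‖x‖ := by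
  rw [alignedDir, norm_smul, Real.norm_eq_abs, abs_signOne, one_mul]

lemma inner_alignedDir_sq {d : ℕ} (g x z : Pt d) :
    (inner ℝ (alignedDir g x) z) ^ 2 = (inner ℝ x z) ^ 2 := by
  rw [alignedDir, inner_smul_left, mul_pow]; simp [signOne_sq]

lemma integrable_inner_alignedDir {d : ℕ} (hd : 1 ≤ d) {r : ℝ} (hr : 0 ≤ r) (g z : Pt d) :
    Integrable (fun x => inner ℝ (alignedDir g x) z) (uniformSphere d r) :=
  integrable_uniformSphere hd hr (by fun_prop) (r * ‖z‖) fun x hx =>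
    abs_inner_le_of_norm_eq ((norm_alignedDir g x).trans hx)

lemma integral_inner_alignedDir {d : ℕ} (hd : 1 ≤ d) {r : ℝ} (hr : 0 ≤ r)
    {g : Pt d} (hg : ‖g‖ = 1) (z : Pt d) :
    ∫ x, inner ℝ (alignedDir g x) z ∂(uniformSphere d r) =
      (∫ x, |inner ℝ x g| ∂(uniformSphere d r)) * inner ℝ g z := by
  rw [← integral_signOne_mul_inner_uniformSphere hd hr hg]
  simp [alignedDir, inner_smul_left]

lemma integral_norm_add_alignedDir_sq {d : ℕ} (hd : 1 ≤ d) {r : ℝ} (hr : 0 ≤ r)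
    {g : Pt d} (hg : ‖g‖ = 1) (z : Pt d) :
    ∫ x, ‖z + alignedDir g x‖ ^ 2 ∂(uniformSphere d r) =
      ‖z‖ ^ 2 + r ^ 2 + 2 * ((∫ x, |inner ℝ x g| ∂(uniformSphere d r)) * inner ℝ g z) := by
  have := isProbabilityMeasure_uniformSphere hd r
  have h1 : ∫ x, ‖z + alignedDir g x‖ ^ 2 ∂(uniformSphere d r) =
      ∫ x, ((‖z‖ ^ 2 + r ^ 2) + 2 * inner ℝ (alignedDir g x) z) ∂(uniformSphere d r) := by
    apply integral_congr_ae
    filter_upwards [ae_norm_uniformSphere d hr] with x hx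
    rw [norm_add_sq_real, norm_alignedDir, hx, real_inner_comm]; ring
  rw [h1, integral_add (integrable_const _) ((integrable_inner_alignedDir hd hr g z).const_mul 2),
    integral_const_mul, integral_inner_alignedDir hd hr hg]
  simp

lemma integral_norm_add_alignedDir_pow_four_le {d : ℕ} (hd : 1 ≤ d) {r : ℝ} (hr : 0 < r)
    (hr1 : r ≤ 1) (hrd : 1 ≤ d * r ^ 2) {g : Pt d} (hg : ‖g‖ = 1) (z : Pt d) :
    ∫ x, ‖z + alignedDir g x‖ ^ 4 ∂(uniformSphere d r) ≤
      (1 + 2 * r ^ 2) * ‖z‖ ^ 4 + 10 * r ^ 2 * ‖z‖ ^ 2 + 3 * r ^ 4 := by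
  have := isProbabilityMeasure_uniformSphere hd r
  have hd' : (1 : ℝ) ≤ d := by exact_mod_cast hd
  set c := ∫ x, |inner ℝ x g| ∂(uniformSphere d r) with hc
  have hc0 : 0 ≤ c := integral_nonneg fun _ => abs_nonneg _
  have hcr : c ≤ r ^ 2 := by
    refine (integral_abs_inner_uniformSphere_le hd hr hg).trans ?_
    rw [div_le_iff₀ (Real.sqrt_pos.2 (by positivity))]
    have : 1 ≤ r * Real.sqrt d := by
      rw [← Real.sqrt_sq hr.le, ← Real.sqrt_mul (by positivity)]
      exact Real.one_le_sqrt.2 (by linarith)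
    nlinarith
  set q := ‖z‖ ^ 2 with hq
  have h1 : ∫ x, ‖z + alignedDir g x‖ ^ 4 ∂(uniformSphere d r) =
      ∫ x, ((q + r ^ 2) ^ 2 + (4 * (q + r ^ 2)) * inner ℝ (alignedDir g x) z +
        4 * (inner ℝ x z) ^ 2) ∂(uniformSphere d r) := by
    apply integral_congr_ae
    filter_upwards [ae_norm_uniformSphere d hr.le] with x hx
    rw [← inner_alignedDir_sq g x z,
      show ‖z + alignedDir g x‖ ^ 4 = (‖z + alignedDir g x‖ ^ 2) ^ 2 by ring,
      norm_add_sq_real, norm_alignedDir, hx, real_inner_comm, ← hq]; ring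
  have hi1 : Integrable (fun x => (q + r ^ 2) ^ 2 + (4 * (q + r ^ 2)) * inner ℝ (alignedDir g x) z)
      (uniformSphere d r) :=
    (integrable_const _).add ((integrable_inner_alignedDir hd hr.le g z).const_mul _)
  rw [h1, integral_add hi1 ((integrable_inner_pow_uniformSphere hd hr.le z 2).const_mul 4),
    integral_add (integrable_const _) ((integrable_inner_alignedDir hd hr.le g z).const_mul _),
    integral_const_mul, integral_const_mul, integral_inner_alignedDir hd hr.le hg,
    integral_inner_sq_uniformSphere hd hr.le, ← hc]
  simp only [integral_const, probReal_univ, smul_eq_mul, one_mul, ← hq]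
  have hq0 : 0 ≤ q := by positivity
  have hgz : inner ℝ g z ≤ (q + 1) / 2 := by
    have := real_inner_le_norm g z
    rw [hg, one_mul] at this
    nlinarith [sq_nonneg (‖z‖ - 1)]
  have h2 : c * inner ℝ g z ≤ r ^ 2 * ((q + 1) / 2) :=
    (mul_le_mul_of_nonneg_left hgz hc0).trans (mul_le_mul_of_nonneg_right hcr (by positivity))
  have h3 := mul_le_mul_of_nonneg_left h2 (by positivity : 0 ≤ 4 * (q + r ^ 2))
  have h4 : r ^ 2 * q / d ≤ r ^ 2 * q := div_le_self (by positivity) hd'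
  have h5 : r ^ 4 * q ≤ r ^ 2 * q := by
    have : r ^ 4 ≤ r ^ 2 := pow_le_pow_of_le_one hr.le hr1 (by norm_num)
    gcongr
  have h6 : ‖z‖ ^ 4 = q ^ 2 := by rw [hq]; ring
  rw [h6]
  nlinarith

section SignedSums

variable {Ω : Type*} [MeasurableSpace Ω] {P : Measure Ω} {d n : ℕ}

lemma norm_sum_alignedDir_le {r : ℝ} {u : Fin n → Pt d} (hu : ∀ i, ‖u i‖ = r) (g : Pt d)
    (s : Finset (Fin n)) : ‖∑ i ∈ s, alignedDir g (u i)‖ ≤ n * r := by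
  refine (norm_sum_le _ _).trans ?_
  simp only [norm_alignedDir, hu, Finset.sum_const, nsmul_eq_mul]
  rcases s.eq_empty_or_nonempty with rfl | ⟨i, hi⟩
  · rcases Nat.eq_zero_or_pos n with rfl | hn
    · simp
    · have : 0 ≤ r := hu ⟨0, hn⟩ ▸ norm_nonneg _
      simp; positivity
  · have : 0 ≤ r := hu i ▸ norm_nonneg _
    have h2 : s.card ≤ n := by simpa using s.card_le_univ
    gcongr

lemma ae_norm_eq_of_hasLaw {r : ℝ} (hr : 0 ≤ r) {u : Fin n → Ω → Pt d}
    (hlaw : ∀ i, HasLaw (u i) (uniformSphere d r) P) : ∀ᵐ ω ∂P, ∀ i, ‖u i ω‖ = r := by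
  rw [ae_all_iff]
  intro i
  have h := ae_norm_uniformSphere d hr
  rw [← (hlaw i).map_eq] at h
  exact ae_of_ae_map (hlaw i).aemeasurable h

lemma integrable_inner_alignedDir_comp {r : ℝ} (hr : 0 ≤ r) (hd : 1 ≤ d) {u : Fin n → Ω → Pt d}
    (hlaw : ∀ i, HasLaw (u i) (uniformSphere d r) P) (g z : Pt d) (i : Fin n) :
    Integrable (fun ω => inner ℝ (alignedDir g (u i ω)) z) P := by
  have h := integrable_inner_alignedDir hd hr g z
  rw [← (hlaw i).map_eq] at h
  exact h.comp_aemeasurable (hlaw i).aemeasurable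

lemma integral_inner_sum_alignedDir {r : ℝ} (hr : 0 ≤ r) (hd : 1 ≤ d) {u : Fin n → Ω → Pt d}
    (hlaw : ∀ i, HasLaw (u i) (uniformSphere d r) P) {g : Pt d} (hg : ‖g‖ = 1) (z : Pt d)
    (s : Finset (Fin n)) :
    ∫ ω, inner ℝ (∑ i ∈ s, alignedDir g (u i ω)) z ∂P =
      s.card * ((∫ x, |inner ℝ x g| ∂(uniformSphere d r)) * inner ℝ g z) := by
  simp only [sum_inner]
  rw [integral_finsetSum _ fun i _ => integrable_inner_alignedDir_comp hr hd hlaw g z i]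
  have : ∀ i, ∫ ω, inner ℝ (alignedDir g (u i ω)) z ∂P =
      (∫ x, |inner ℝ x g| ∂(uniformSphere d r)) * inner ℝ g z := by
    intro i
    rw [← integral_inner_alignedDir hd hr hg]
    exact (hlaw i).integral_comp (f := fun x => inner ℝ (alignedDir g x) z)
      (by fun_prop)
  simp [this]

lemma indepFun_sum_alignedDir {u : Fin n → Ω → Pt d} (hmeas : ∀ i, Measurable (u i))
    (hindep : iIndepFun u P) (g : Pt d) {s : Finset (Fin n)} {i : Fin n} (hi : i ∉ s) :
    IndepFun (fun ω => ∑ j ∈ s, alignedDir g (u j ω)) (u i) P := by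
  have h := (hindep.indepFun_finset s {i} (by simpa using hi) hmeas)
  have hψ : Measurable (fun x : ({i} : Finset (Fin n)) → Pt d => x ⟨i, by simp⟩) :=
    measurable_pi_apply _
  have h2 := h.comp (φ := fun x : (j : s) → Pt d => ∑ j : s, alignedDir g (x j))
    (by fun_prop) hψ
  convert h2 using 1
  · ext1 ω
    exact (Finset.sum_coe_sort s (fun j => alignedDir g (u j ω))).symm
  · rfl

variable [IsProbabilityMeasure P]

lemma integrable_norm_sum_alignedDir_pow {r : ℝ} (hr : 0 ≤ r) {u : Fin n → Ω → Pt d}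
    (hmeas : ∀ i, Measurable (u i)) (hlaw : ∀ i, HasLaw (u i) (uniformSphere d r) P) (g : Pt d)
    (s : Finset (Fin n)) (k : ℕ) :
    Integrable (fun ω => ‖∑ i ∈ s, alignedDir g (u i ω)‖ ^ k) P := by
  refine Integrable.of_bound
    (Measurable.aestronglyMeasurable (by fun_prop)) ((n * r) ^ k) ?_
  filter_upwards [ae_norm_eq_of_hasLaw hr hlaw] with ω hω
  rw [norm_pow, norm_norm]
  gcongr
  exact norm_sum_alignedDir_le hω g s

/-- Adding one more independent direction to a partial sum: the mean of a power of the norm is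
obtained by averaging first over the new direction. -/
lemma integral_norm_sum_insert_pow {r : ℝ} (hr : 0 ≤ r) {u : Fin n → Ω → Pt d}
    (hmeas : ∀ i, Measurable (u i)) (hlaw : ∀ i, HasLaw (u i) (uniformSphere d r) P)
    (hindep : iIndepFun u P) (g : Pt d) {s : Finset (Fin n)} {i : Fin n} (hi : i ∉ s) (k : ℕ) :
    ∫ ω, ‖∑ j ∈ insert i s, alignedDir g (u j ω)‖ ^ k ∂P =
      ∫ ω, ∫ x, ‖(∑ j ∈ s, alignedDir g (u j ω)) + alignedDir g x‖ ^ k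
        ∂(uniformSphere d r) ∂P := by
  have hint := integrable_norm_sum_alignedDir_pow hr hmeas hlaw g (insert i s) k
  simp only [Finset.sum_insert hi, add_comm (alignedDir g (u i _))] at hint ⊢
  rw [(indepFun_sum_alignedDir hmeas hindep g hi).integral_comp_prodMk (by fun_prop) (hmeas i)
    (φ := fun z x => ‖z + alignedDir g x‖ ^ k) (by fun_prop) hint]
  congr 1; ext ω
  exact (hlaw i).integral_comp
    (f := fun x => ‖(∑ j ∈ s, alignedDir g (u j ω)) + alignedDir g x‖ ^ k) (by fun_prop)

lemma integral_norm_sum_alignedDir_sq {r : ℝ} (hr : 0 ≤ r) (hd : 1 ≤ d) {u : Fin n → Ω → Pt d}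
    (hmeas : ∀ i, Measurable (u i)) (hlaw : ∀ i, HasLaw (u i) (uniformSphere d r) P)
    (hindep : iIndepFun u P) {g : Pt d} (hg : ‖g‖ = 1) (s : Finset (Fin n)) :
    ∫ ω, ‖∑ i ∈ s, alignedDir g (u i ω)‖ ^ 2 ∂P =
      s.card * r ^ 2 + s.card * (s.card - 1) * (∫ x, |inner ℝ x g| ∂(uniformSphere d r)) ^ 2 := by
  set c := ∫ x, |inner ℝ x g| ∂(uniformSphere d r)
  induction s using Finset.induction_on with
  | empty => simp
  | insert i s hi ih =>
    have hI : Integrable (fun ω => inner ℝ (∑ j ∈ s, alignedDir g (u j ω)) g) P := by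
      simp only [sum_inner]
      exact integrable_finsetSum _ fun j _ => integrable_inner_alignedDir_comp hr hd hlaw g g j
    have h2 := integrable_norm_sum_alignedDir_pow hr hmeas hlaw g s 2
    have h3 := integral_inner_sum_alignedDir hr hd hlaw hg g s
    rw [real_inner_self_eq_norm_sq, hg] at h3
    rw [integral_norm_sum_insert_pow hr hmeas hlaw hindep g hi]
    simp only [integral_norm_add_alignedDir_sq hd hr hg]
    have hI' : Integrable (fun ω => 2 * (c * inner ℝ g (∑ j ∈ s, alignedDir g (u j ω)))) P := by
      simp only [real_inner_comm _ g]
      exact (hI.const_mul c).const_mul 2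
    have hI2 : Integrable (fun ω => ‖∑ j ∈ s, alignedDir g (u j ω)‖ ^ 2 + r ^ 2) P :=
      h2.add (integrable_const _)
    rw [integral_add hI2 hI', integral_add h2 (integrable_const _), ih, integral_const_mul,
      integral_const_mul]
    simp only [real_inner_comm _ g] at h3 ⊢
    rw [h3, Finset.card_insert_of_notMem hi]
    simp only [integral_const, probReal_univ, smul_eq_mul]
    push_cast
    ring

lemma integral_norm_sum_alignedDir_sq_le {r : ℝ} (hr : 0 < r) (hd : 1 ≤ d)
    (hrd : 1 ≤ d * r ^ 2) (hrn : n * r ^ 2 = 1) {u : Fin n → Ω → Pt d}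
    (hmeas : ∀ i, Measurable (u i)) (hlaw : ∀ i, HasLaw (u i) (uniformSphere d r) P)
    (hindep : iIndepFun u P) {g : Pt d} (hg : ‖g‖ = 1) (s : Finset (Fin n)) :
    ∫ ω, ‖∑ i ∈ s, alignedDir g (u i ω)‖ ^ 2 ∂P ≤ 2 := by
  rw [integral_norm_sum_alignedDir_sq hr.le hd hmeas hlaw hindep hg]
  have hd' : (1 : ℝ) ≤ d := by exact_mod_cast hd
  set c := ∫ x, |inner ℝ x g| ∂(uniformSphere d r) with hc
  have hc0 : 0 ≤ c := integral_nonneg fun _ => abs_nonneg _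
  have hcr : c ^ 2 ≤ r ^ 2 / d := by
    calc c ^ 2 ≤ (r / Real.sqrt d) ^ 2 := by
          gcongr; exact integral_abs_inner_uniformSphere_le hd hr hg
      _ = r ^ 2 / d := by rw [div_pow, Real.sq_sqrt (by positivity)]
  have hcr' : c ^ 2 ≤ (r ^ 2) ^ 2 := by
    refine hcr.trans ?_
    rw [div_le_iff₀ (by positivity)]
    nlinarith [sq_nonneg r]
  have hk : (s.card : ℝ) ≤ n := by
    have : s.card ≤ n := by simpa using s.card_le_univ
    exact_mod_cast this
  have hk0 : (0 : ℝ) ≤ s.card := by positivity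
  have h1 : (s.card : ℝ) * r ^ 2 ≤ 1 := by
    rw [← hrn]; gcongr
  have h2 : (s.card : ℝ) * (s.card - 1) * c ^ 2 ≤ (s.card : ℝ) ^ 2 * (r ^ 2) ^ 2 := by
    have : (s.card : ℝ) * (s.card - 1) * c ^ 2 ≤ (s.card : ℝ) ^ 2 * c ^ 2 := by
      gcongr; nlinarith
    refine this.trans ?_
    gcongr
  have h3 : (s.card : ℝ) ^ 2 * (r ^ 2) ^ 2 ≤ 1 := by
    rw [← mul_pow]
    exact pow_le_one₀ (by positivity) h1
  linarith

lemma integral_norm_sum_alignedDir_pow_four_le {r : ℝ} (hr : 0 < r) (hr1 : r ≤ 1) (hd : 1 ≤ d)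
    (hrd : 1 ≤ d * r ^ 2) (hrn : n * r ^ 2 = 1) {u : Fin n → Ω → Pt d}
    (hmeas : ∀ i, Measurable (u i)) (hlaw : ∀ i, HasLaw (u i) (uniformSphere d r) P)
    (hindep : iIndepFun u P) {g : Pt d} (hg : ‖g‖ = 1) :
    ∫ ω, ‖∑ i, alignedDir g (u i ω)‖ ^ 4 ∂P ≤ 207 := by
  -- each direction multiplies the fourth moment by `1 + 2 r ^ 2` and adds at most `10 r ^ 2 * 2`
  -- for the second moment and `3 r ^ 4`
  have key : ∀ s : Finset (Fin n), ∫ ω, ‖∑ i ∈ s, alignedDir g (u i ω)‖ ^ 4 ∂P ≤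
      (1 + 2 * r ^ 2) ^ s.card * (s.card * (23 * r ^ 2)) := by
    intro s
    induction s using Finset.induction_on with
    | empty => simp
    | insert i s hi ih =>
      have h2 := integrable_norm_sum_alignedDir_pow hr.le hmeas hlaw g s 2
      have h4 := integrable_norm_sum_alignedDir_pow hr.le hmeas hlaw g s 4
      have hA := integral_norm_sum_alignedDir_sq_le hr hd hrd hrn hmeas hlaw hindep hg s
      have hsum : Integrable (fun ω => (1 + 2 * r ^ 2) * ‖∑ j ∈ s, alignedDir g (u j ω)‖ ^ 4 +
          10 * r ^ 2 * ‖∑ j ∈ s, alignedDir g (u j ω)‖ ^ 2) P :=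
        (h4.const_mul _).add (h2.const_mul _)
      have hbound : ∫ ω, ‖∑ j ∈ insert i s, alignedDir g (u j ω)‖ ^ 4 ∂P ≤
          ∫ ω, ((1 + 2 * r ^ 2) * ‖∑ j ∈ s, alignedDir g (u j ω)‖ ^ 4 +
            10 * r ^ 2 * ‖∑ j ∈ s, alignedDir g (u j ω)‖ ^ 2 + 3 * r ^ 4) ∂P := by
        rw [integral_norm_sum_insert_pow hr.le hmeas hlaw hindep g hi]
        refine integral_mono_of_nonneg (Filter.Eventually.of_forall fun ω =>
          integral_nonneg fun x => by positivity) (hsum.add (integrable_const _))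
          (Filter.Eventually.of_forall fun ω =>
            integral_norm_add_alignedDir_pow_four_le hd hr hr1 hrd hg _)
      rw [integral_add hsum (integrable_const _), integral_add (h4.const_mul _) (h2.const_mul _),
        integral_const_mul, integral_const_mul] at hbound
      simp only [integral_const, probReal_univ, smul_eq_mul, one_mul] at hbound
      refine hbound.trans ?_
      rw [Finset.card_insert_of_notMem hi]
      push_cast
      have h1 : (1 : ℝ) ≤ (1 + 2 * r ^ 2) ^ (s.card + 1) :=
        one_le_pow₀ (by nlinarith [sq_nonneg r])
      have h5 : r ^ 4 ≤ r ^ 2 := pow_le_pow_of_le_one hr.le hr1 (by norm_num)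
      have h6 : 10 * r ^ 2 * ∫ ω, ‖∑ j ∈ s, alignedDir g (u j ω)‖ ^ 2 ∂P ≤ 10 * r ^ 2 * 2 := by
        gcongr
      have h7 := mul_le_mul_of_nonneg_left ih (by positivity : 0 ≤ 1 + 2 * r ^ 2)
      have h8 : 23 * r ^ 2 ≤ (1 + 2 * r ^ 2) ^ (s.card + 1) * (23 * r ^ 2) :=
        le_mul_of_one_le_left (by positivity) h1
      calc _ ≤ (1 + 2 * r ^ 2) * ((1 + 2 * r ^ 2) ^ s.card * (s.card * (23 * r ^ 2))) +
            23 * r ^ 2 := by linarith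
        _ ≤ (1 + 2 * r ^ 2) * ((1 + 2 * r ^ 2) ^ s.card * (s.card * (23 * r ^ 2))) +
            (1 + 2 * r ^ 2) ^ (s.card + 1) * (23 * r ^ 2) := by linarith
        _ = _ := by ring
  have h := key Finset.univ
  rw [Finset.card_univ, Fintype.card_fin] at h
  have h1 : (n : ℝ) * (23 * r ^ 2) = 23 := by linarith
  have h2 : (1 + 2 * r ^ 2) ^ n ≤ 9 := by
    have h3 : 1 + 2 * r ^ 2 ≤ Real.exp (2 * r ^ 2) := by
      linarith [Real.add_one_le_exp (2 * r ^ 2)]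
    calc (1 + 2 * r ^ 2) ^ n ≤ Real.exp (2 * r ^ 2) ^ n := by gcongr
      _ = Real.exp 1 ^ 2 := by
        rw [← Real.exp_nat_mul, ← Real.exp_nat_mul]; congr 1; push_cast; linarith
      _ ≤ 3 ^ 2 := by gcongr; linarith [Real.exp_one_lt_d9]
      _ = 9 := by norm_num
  rw [h1] at h
  linarith

end SignedSums

section SignedSums

variable {Ω : Type*} [MeasurableSpace Ω] {P : Measure Ω} {d n : ℕ}

/-- The number of the directions that are orthogonal to `g` up to the threshold `t`. -/
noncomputable def nearOrthCount (g : Pt d) (t : ℝ) (u : Fin n → Pt d) : ℝ :=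
  ∑ i, {x : Pt d | |inner ℝ x g| ≤ t}.indicator (fun _ => (1 : ℝ)) (u i)

lemma nearOrthCount_nonneg (g : Pt d) (t : ℝ) (u : Fin n → Pt d) : 0 ≤ nearOrthCount g t u :=
  Finset.sum_nonneg fun _ _ => Set.indicator_nonneg (fun _ _ => zero_le_one) _

lemma nearOrthCount_le (g : Pt d) (t : ℝ) (u : Fin n → Pt d) : nearOrthCount g t u ≤ n := by
  refine (Finset.sum_le_sum (g := fun _ => (1 : ℝ)) fun i _ =>
    Set.indicator_le_self' (fun _ _ => zero_le_one) _).trans ?_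
  simp

lemma measurableSet_abs_inner_le (g : Pt d) (t : ℝ) :
    MeasurableSet {x : Pt d | |inner ℝ x g| ≤ t} :=
  measurableSet_le (by fun_prop) (by fun_prop)

@[fun_prop]
lemma measurable_nearOrthCount (g : Pt d) (t : ℝ) :
    Measurable (fun u : Fin n → Pt d => nearOrthCount g t u) :=
  Finset.measurable_sum _ fun i _ =>
    (measurable_const.indicator (measurableSet_abs_inner_le g t)).comp (measurable_pi_apply i)

/-- A choice of signs that agrees with that of `alignedDir` for the directions which are not nearly
orthogonal to `g` changes the sum of the directions by at most twice their length for each of the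
others. -/
lemma norm_sum_smul_sub_sum_alignedDir_le {r t : ℝ} {g : Pt d} {u : Fin n → Pt d} {v : Fin n → ℝ}
    (hu : ∀ i, ‖u i‖ = r) (hv : ∀ i, |v i| = 1)
    (hvs : ∀ i, t < |inner ℝ (u i) g| → v i = signOne (inner ℝ (u i) g)) :
    ‖∑ i, v i • u i - ∑ i, alignedDir g (u i)‖ ≤ 2 * r * nearOrthCount g t u := by
  rw [← Finset.sum_sub_distrib, nearOrthCount, Finset.mul_sum]
  refine (norm_sum_le _ _).trans (Finset.sum_le_sum fun i _ => ?_)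
  rw [alignedDir, ← sub_smul, norm_smul, hu]
  rcases le_or_gt |inner ℝ (u i) g| t with h | h
  · rw [Set.indicator_of_mem (by exact h)]
    have h1 : ‖v i - signOne (inner ℝ (u i) g)‖ ≤ 2 := by
      refine (norm_sub_le _ _).trans ?_
      rw [Real.norm_eq_abs, Real.norm_eq_abs, hv, abs_signOne]; norm_num
    have : 0 ≤ r := hu i ▸ norm_nonneg _
    nlinarith
  · rw [hvs i h, Set.indicator_of_notMem (by simpa using h)]; simp

/-- The hypotheses on the sampled directions `u i` and on signs `v i` derived from winner feedback:
the directions are independent and uniform on a sphere of radius `r = 1 / √n`, and each sign is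
that of `⟨u i, g⟩` unless this number is at most `t` in absolute value, which has probability at
most `p`. -/
structure SignedDirections (P : Measure Ω) (r t p : ℝ) (g : Pt d) (u : Fin n → Ω → Pt d)
    (v : Fin n → Ω → ℝ) : Prop where
  one_le_n : 1 ≤ n
  n_le_d : n ≤ d
  r_pos : 0 < r
  n_mul_r_sq : n * r ^ 2 = 1
  norm_g : ‖g‖ = 1
  meas_u : ∀ i, Measurable (u i)
  law : ∀ i, HasLaw (u i) (uniformSphere d r) P
  indep : iIndepFun u P
  meas_v : ∀ i, Measurable (v i)
  abs_v : ∀ i ω, |v i ω| = 1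
  v_eq : ∀ᵐ ω ∂P, ∀ i, t < |inner ℝ (u i ω) g| → v i ω = signOne (inner ℝ (u i ω) g)
  small_ball : (uniformSphere d r).real {x : Pt d | |inner ℝ x g| ≤ t} ≤ p
  p_le : p ≤ 1 / (28 * (d * n))

namespace SignedDirections

variable {r t p : ℝ} {g : Pt d} {u : Fin n → Ω → Pt d} {v : Fin n → Ω → ℝ}

lemma one_le_d (h : SignedDirections P r t p g u v) : 1 ≤ d := h.one_le_n.trans h.n_le_d

lemma r_le_one (h : SignedDirections P r t p g u v) : r ≤ 1 := by
  have h1 := h.n_mul_r_sq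
  have h2 : (1 : ℝ) ≤ n := by exact_mod_cast h.one_le_n
  have := h.r_pos
  by_contra h3
  push Not at h3
  nlinarith

lemma one_le_d_mul (h : SignedDirections P r t p g u v) : 1 ≤ d * r ^ 2 := by
  rw [← h.n_mul_r_sq]
  have : (n : ℝ) ≤ d := by exact_mod_cast h.n_le_d
  gcongr

lemma integrable_nearOrthCount [IsProbabilityMeasure P]
    (h : SignedDirections P r t p g u v) :
    Integrable (fun ω => nearOrthCount g t (fun i => u i ω)) P := by
  have := h.meas_u
  refine Integrable.of_bound (Measurable.aestronglyMeasurable (by fun_prop)) n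
    (Filter.Eventually.of_forall fun ω => ?_)
  rw [Real.norm_of_nonneg (nearOrthCount_nonneg _ _ _)]
  exact nearOrthCount_le _ _ _

lemma integral_nearOrthCount_le [IsProbabilityMeasure P]
    (h : SignedDirections P r t p g u v) :
    ∫ ω, nearOrthCount g t (fun i => u i ω) ∂P ≤ n * p := by
  have hset := measurableSet_abs_inner_le g t
  have h1 : ∀ i, ∫ ω, {x : Pt d | |inner ℝ x g| ≤ t}.indicator (fun _ => (1 : ℝ)) (u i ω) ∂P ≤ p := by
    intro i
    refine le_trans (le_of_eq ?_) h.small_ball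
    rw [show ∫ ω, {x : Pt d | |inner ℝ x g| ≤ t}.indicator (fun _ => (1 : ℝ)) (u i ω) ∂P =
      ∫ x, {x : Pt d | |inner ℝ x g| ≤ t}.indicator (fun _ => (1 : ℝ)) x ∂(uniformSphere d r) from
        (h.law i).integral_comp (measurable_const.indicator hset).aestronglyMeasurable,
      integral_indicator hset]
    simp
  unfold nearOrthCount
  rw [integral_finsetSum _ fun i _ => ?_]
  · refine (Finset.sum_le_sum fun i _ => h1 i).trans ?_
    simp
  · refine Integrable.of_bound ((measurable_const.indicator hset).comp
      (h.meas_u i)).aestronglyMeasurable 1 (Filter.Eventually.of_forall fun ω => ?_)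
    rw [Real.norm_of_nonneg (Set.indicator_nonneg (fun _ _ => zero_le_one) _)]
    exact Set.indicator_le_self' (fun _ _ => zero_le_one) _

lemma ae_norm_sub_le (h : SignedDirections P r t p g u v) :
    ∀ᵐ ω ∂P, ‖∑ i, v i ω • u i ω - ∑ i, alignedDir g (u i ω)‖ ≤
      2 * r * nearOrthCount g t (fun i => u i ω) := by
  filter_upwards [ae_norm_eq_of_hasLaw h.r_pos.le h.law, h.v_eq] with ω hω hv
  exact norm_sum_smul_sub_sum_alignedDir_le hω (fun i => h.abs_v i ω) hv

lemma measurable_sum (h : SignedDirections P r t p g u v) :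
    Measurable (fun ω => ∑ i, v i ω • u i ω) :=
  Finset.measurable_sum _ fun i _ => (h.meas_v i).smul (h.meas_u i)

lemma ae_norm_sum_le (h : SignedDirections P r t p g u v) :
    ∀ᵐ ω ∂P, ‖∑ i, v i ω • u i ω‖ ≤ n * r := by
  filter_upwards [ae_norm_eq_of_hasLaw h.r_pos.le h.law] with ω hω
  refine (norm_sum_le _ _).trans ?_
  simp [norm_smul, hω, h.abs_v]

lemma integrable_norm_pow [IsProbabilityMeasure P]
    (h : SignedDirections P r t p g u v) (k : ℕ) :
    Integrable (fun ω => ‖∑ i, v i ω • u i ω‖ ^ k) P := by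
  refine Integrable.of_bound (h.measurable_sum.norm.pow_const k).aestronglyMeasurable
    ((n * r) ^ k) ?_
  filter_upwards [h.ae_norm_sum_le] with ω hω
  rw [norm_pow, norm_norm]
  gcongr

lemma integrable_inner [IsProbabilityMeasure P]
    (h : SignedDirections P r t p g u v) (z : Pt d) :
    Integrable (fun ω => inner ℝ (∑ i, v i ω • u i ω) z) P := by
  refine Integrable.of_bound (h.measurable_sum.inner_const).aestronglyMeasurable
    (n * r * ‖z‖) ?_
  filter_upwards [h.ae_norm_sum_le] with ω hω
  exact (norm_inner_le_norm _ _).trans (by gcongr)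

lemma le_integral_inner [IsProbabilityMeasure P]
    (h : SignedDirections P r t p g u v) (z : Pt d) :
    n * ((∫ x, |inner ℝ x g| ∂(uniformSphere d r)) * inner ℝ g z - 2 * r * ‖z‖ * p) ≤
      ∫ ω, inner ℝ (∑ i, v i ω • u i ω) z ∂P := by
  have hX := integral_inner_sum_alignedDir h.r_pos.le h.one_le_d h.law h.norm_g z Finset.univ
  rw [Finset.card_univ, Fintype.card_fin] at hX
  have hB := h.integrable_nearOrthCount
  have hXi : Integrable (fun ω => inner ℝ (∑ i, alignedDir g (u i ω)) z) P := by
    simp only [sum_inner]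
    exact integrable_finsetSum _ fun i _ =>
      integrable_inner_alignedDir_comp h.r_pos.le h.one_le_d h.law g z i
  have hmono : ∫ ω, (inner ℝ (∑ i, alignedDir g (u i ω)) z -
      2 * r * ‖z‖ * nearOrthCount g t (fun i => u i ω)) ∂P ≤
      ∫ ω, inner ℝ (∑ i, v i ω • u i ω) z ∂P := by
    refine integral_mono_ae (hXi.sub (hB.const_mul _)) (h.integrable_inner z) ?_
    filter_upwards [h.ae_norm_sub_le] with ω hω
    have h1 := abs_real_inner_le_norm (∑ i, v i ω • u i ω - ∑ i, alignedDir g (u i ω)) z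
    have h2 := mul_le_mul_of_nonneg_right hω (norm_nonneg z)
    have h3 := neg_abs_le (inner ℝ (∑ i, v i ω • u i ω - ∑ i, alignedDir g (u i ω)) z)
    rw [inner_sub_left] at h1 h3
    linarith
  rw [integral_sub hXi (hB.const_mul _), integral_const_mul, hX] at hmono
  have h4 := mul_le_mul_of_nonneg_left h.integral_nearOrthCount_le
    (by have := h.r_pos; positivity : 0 ≤ 2 * r * ‖z‖)
  linarith

lemma n_mul_p_le (h : SignedDirections P r t p g u v) : n * p ≤ 1 / 28 := by
  have h2 : (1 : ℝ) ≤ n := by exact_mod_cast h.one_le_n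
  have h3 : (1 : ℝ) ≤ d := by exact_mod_cast h.one_le_d
  calc n * p ≤ n * (1 / (28 * (d * n))) := by have := h.p_le; gcongr
    _ = 1 / 28 * (1 / d) := by field_simp
    _ ≤ 1 / 28 := mul_le_of_le_one_right (by norm_num) (by rw [div_le_one (by positivity)]; exact h3)

lemma n_sq_mul_p_le (h : SignedDirections P r t p g u v) : n * (n * p) ≤ 1 / 28 := by
  have h2 : (1 : ℝ) ≤ n := by exact_mod_cast h.one_le_n
  have h3 : (1 : ℝ) ≤ d := by exact_mod_cast h.one_le_d
  have h4 : (n : ℝ) ≤ d := by exact_mod_cast h.n_le_d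
  calc n * (n * p) ≤ n * (n * (1 / (28 * (d * n)))) := by have := h.p_le; gcongr
    _ = 1 / 28 * (n / d) := by field_simp
    _ ≤ 1 / 28 := mul_le_of_le_one_right (by norm_num) (by rw [div_le_one (by positivity)]; exact h4)

lemma integral_norm_sq_le [IsProbabilityMeasure P]
    (h : SignedDirections P r t p g u v) :
    ∫ ω, ‖∑ i, v i ω • u i ω‖ ^ 2 ∂P ≤ 9 / 2 := by
  have hX := integral_norm_sum_alignedDir_sq_le h.r_pos h.one_le_d h.one_le_d_mul h.n_mul_r_sq
    h.meas_u h.law h.indep h.norm_g Finset.univ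
  have hXi := integrable_norm_sum_alignedDir_pow h.r_pos.le h.meas_u h.law g Finset.univ 2
  have hB := h.integrable_nearOrthCount
  have hmono : ∫ ω, ‖∑ i, v i ω • u i ω‖ ^ 2 ∂P ≤
      ∫ ω, (2 * ‖∑ i, alignedDir g (u i ω)‖ ^ 2 + 8 * nearOrthCount g t (fun i => u i ω)) ∂P := by
    refine integral_mono_ae (h.integrable_norm_pow 2) ((hXi.const_mul _).add (hB.const_mul _)) ?_
    filter_upwards [h.ae_norm_sub_le] with ω hω
    set G := ∑ i, v i ω • u i ω
    set X := ∑ i, alignedDir g (u i ω)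
    set B := nearOrthCount g t (fun i => u i ω)
    have hB0 : 0 ≤ B := nearOrthCount_nonneg _ _ _
    have hBn : B ≤ n := nearOrthCount_le _ _ _
    have h1 : ‖G‖ ≤ ‖X‖ + ‖G - X‖ := by
      simpa using norm_add_le X (G - X)
    have h2 : ‖G‖ ^ 2 ≤ 2 * ‖X‖ ^ 2 + 2 * ‖G - X‖ ^ 2 := by
      nlinarith [sq_nonneg (‖X‖ - ‖G - X‖), norm_nonneg G]
    have h3 : ‖G - X‖ ^ 2 ≤ 4 * B := by
      calc ‖G - X‖ ^ 2 ≤ (2 * r * B) ^ 2 := by gcongr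
        _ = 4 * r ^ 2 * B * B := by ring
        _ ≤ 4 * r ^ 2 * n * B := by gcongr
        _ = 4 * B := by linear_combination 4 * B * h.n_mul_r_sq
    linarith
  rw [integral_add (hXi.const_mul _) (hB.const_mul _), integral_const_mul,
    integral_const_mul] at hmono
  have := h.integral_nearOrthCount_le
  have := h.n_mul_p_le
  linarith

lemma integral_norm_pow_four_le [IsProbabilityMeasure P]
    (h : SignedDirections P r t p g u v) :
    ∫ ω, ‖∑ i, v i ω • u i ω‖ ^ 4 ∂P ≤ 1700 := by
  have hX := integral_norm_sum_alignedDir_pow_four_le h.r_pos h.r_le_one h.one_le_d h.one_le_d_mul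
    h.n_mul_r_sq h.meas_u h.law h.indep h.norm_g
  have hXi := integrable_norm_sum_alignedDir_pow h.r_pos.le h.meas_u h.law g Finset.univ 4
  have hB := h.integrable_nearOrthCount
  have hmono : ∫ ω, ‖∑ i, v i ω • u i ω‖ ^ 4 ∂P ≤
      ∫ ω, (8 * ‖∑ i, alignedDir g (u i ω)‖ ^ 4 +
        128 * n * nearOrthCount g t (fun i => u i ω)) ∂P := by
    refine integral_mono_ae (h.integrable_norm_pow 4) ((hXi.const_mul _).add (hB.const_mul _)) ?_
    filter_upwards [h.ae_norm_sub_le] with ω hω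
    set G := ∑ i, v i ω • u i ω
    set X := ∑ i, alignedDir g (u i ω)
    set B := nearOrthCount g t (fun i => u i ω)
    have hB0 : 0 ≤ B := nearOrthCount_nonneg _ _ _
    have hBn : B ≤ n := nearOrthCount_le _ _ _
    have h1 : ‖G‖ ≤ ‖X‖ + ‖G - X‖ := by
      simpa using norm_add_le X (G - X)
    have h2 : ‖G‖ ^ 4 ≤ 8 * ‖X‖ ^ 4 + 8 * ‖G - X‖ ^ 4 := by
      have h5 := add_pow_le (norm_nonneg X) (norm_nonneg (G - X)) 4
      have h6 : ‖G‖ ^ 4 ≤ (‖X‖ + ‖G - X‖) ^ 4 := by gcongr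
      norm_num at h5
      linarith
    have h3 : ‖G - X‖ ^ 4 ≤ 16 * n * B := by
      calc ‖G - X‖ ^ 4 ≤ (2 * r * B) ^ 4 := by gcongr
        _ = 16 * r ^ 4 * (B * B * B) * B := by ring
        _ ≤ 16 * r ^ 4 * (n * n * n) * B := by gcongr
        _ = 16 * (n * r ^ 2) ^ 2 * n * B := by ring
        _ = 16 * n * B := by rw [h.n_mul_r_sq]; ring
    linarith
  rw [integral_add (hXi.const_mul _) (hB.const_mul _), integral_const_mul,
    integral_const_mul] at hmono
  have h1 := mul_le_mul_of_nonneg_left h.integral_nearOrthCount_le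
    (by positivity : (0 : ℝ) ≤ 128 * n)
  have := h.n_sq_mul_p_le
  linarith

end SignedDirections

end SignedSums

/-! ### Projections and convex functions -/

lemma euclProj_spec {d : ℕ} {K : Set (Pt d)} (hne : K.Nonempty) (hcl : IsClosed K)
    (hconv : Convex ℝ K) (x : Pt d) :
    euclProj K x ∈ K ∧ ∀ y ∈ K, ‖euclProj K x - x‖ ≤ ‖y - x‖ := by
  refine Classical.epsilon_spec (p := fun p : Pt d => p ∈ K ∧ ∀ y ∈ K, ‖p - x‖ ≤ ‖y - x‖) ?_
  obtain ⟨p, hp, hmin⟩ := exists_norm_eq_iInf_of_complete_convex hne hcl.isComplete hconv x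
  refine ⟨p, hp, fun y hy => ?_⟩
  rw [norm_sub_rev p, norm_sub_rev y, hmin]
  exact ciInf_le (f := fun w : K => ‖x - w‖) ⟨0, by rintro _ ⟨w, rfl⟩; exact norm_nonneg _⟩ ⟨y, hy⟩

lemma inner_sub_euclProj_nonpos {d : ℕ} {K : Set (Pt d)} (hne : K.Nonempty) (hcl : IsClosed K)
    (hconv : Convex ℝ K) (x : Pt d) {y : Pt d} (hy : y ∈ K) :
    inner ℝ (x - euclProj K x) (y - euclProj K x) ≤ 0 := by
  obtain ⟨hp, hmin⟩ := euclProj_spec hne hcl hconv x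
  refine (norm_eq_iInf_iff_real_inner_le_zero hconv hp).1 ?_ y hy
  have : Nonempty K := ⟨⟨_, hp⟩⟩
  refine le_antisymm (le_ciInf fun w => ?_)
    (ciInf_le (f := fun w : K => ‖x - w‖) ⟨0, by rintro _ ⟨w, rfl⟩; exact norm_nonneg _⟩ ⟨_, hp⟩)
  rw [norm_sub_rev, norm_sub_rev x]
  exact hmin w w.2

lemma norm_euclProj_sub_euclProj_le {d : ℕ} {K : Set (Pt d)} (hne : K.Nonempty)
    (hcl : IsClosed K) (hconv : Convex ℝ K) (x y : Pt d) :
    ‖euclProj K x - euclProj K y‖ ≤ ‖x - y‖ := by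
  have h1 := inner_sub_euclProj_nonpos hne hcl hconv x (euclProj_spec hne hcl hconv y).1
  have h2 := inner_sub_euclProj_nonpos hne hcl hconv y (euclProj_spec hne hcl hconv x).1
  set p := euclProj K x
  set q := euclProj K y
  have h3 : ‖p - q‖ ^ 2 ≤ inner ℝ (x - y) (p - q) := by
    rw [← real_inner_self_eq_norm_sq]
    have : inner ℝ (x - y) (p - q) - inner ℝ (p - q) (p - q) =
        -inner ℝ (x - p) (q - p) - inner ℝ (y - q) (p - q) := by
      simp only [inner_sub_left, inner_sub_right]; ring
    linarith
  have h4 := real_inner_le_norm (x - y) (p - q)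
  by_contra h
  push Not at h
  nlinarith [norm_nonneg (x - y)]

lemma euclProj_eq_self {d : ℕ} {K : Set (Pt d)} (hcl : IsClosed K)
    (hconv : Convex ℝ K) {x : Pt d} (hx : x ∈ K) : euclProj K x = x := by
  have h := (euclProj_spec ⟨x, hx⟩ hcl hconv x).2 x hx
  simpa [sub_eq_zero] using h

lemma continuous_euclProj {d : ℕ} {K : Set (Pt d)} (hne : K.Nonempty)
    (hcl : IsClosed K) (hconv : Convex ℝ K) : Continuous (euclProj K) :=
  (LipschitzWith.of_dist_le_mul (K := 1) fun x y => by
    simpa [dist_eq_norm] using norm_euclProj_sub_euclProj_le hne hcl hconv x y).continuous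

section Function

variable {d : ℕ} {f : Pt d → ℝ} {α β : ℝ} {xstar : Pt d}

lemma hasDerivAt_comp_line (hf : Differentiable ℝ f) (x h : Pt d) (t : ℝ) :
    HasDerivAt (fun s : ℝ => f (x + s • h)) (inner ℝ (gradient f (x + t • h)) h) t := by
  have h1 : HasDerivAt (fun s : ℝ => x + s • h) h t := by
    simpa using ((hasDerivAt_id t).smul_const h).const_add x
  have h2 := (hf (x + t • h)).hasGradientAt.hasFDerivAt.comp_hasDerivAt t h1
  rw [InnerProductSpace.toDual_apply_apply] at h2
  exact h2

lemma add_inner_gradient_le (hconv : ConvexOn ℝ Set.univ f) (hf : Differentiable ℝ f)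
    (x y : Pt d) : f x + inner ℝ (gradient f x) (y - x) ≤ f y := by
  have hφ : ConvexOn ℝ Set.univ (fun s : ℝ => f (x + s • (y - x))) := by
    have h := hconv.comp_affineMap (AffineMap.lineMap (k := ℝ) x y)
    have he : f ∘ (AffineMap.lineMap (k := ℝ) x y) = fun s : ℝ => f (x + s • (y - x)) := by
      ext s
      simp [AffineMap.lineMap_apply, add_comm]
    rwa [Set.preimage_univ, he] at h
  have h1 := hasDerivAt_comp_line hf x (y - x) 0
  have h2 := hφ.le_slope_of_hasDerivAt (Set.mem_univ 0) (Set.mem_univ 1) zero_lt_one h1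
  simp only [slope_def_field, zero_smul, one_smul, add_zero, add_sub_cancel, sub_zero, div_one] at h2
  linarith

lemma gradient_eq_zero_of_forall_le (hmin : ∀ y, f xstar ≤ f y) : gradient f xstar = 0 := by
  have h : IsLocalMin f xstar := Filter.Eventually.of_forall hmin
  simp [gradient, h.fderiv_eq_zero]

lemma sub_le_of_isSmoothFn (hs : IsSmoothFn β f) (hmin : ∀ y, f xstar ≤ f y) (x : Pt d) :
    f x - f xstar ≤ β / 2 * ‖x - xstar‖ ^ 2 := by
  set h := x - xstar with hh
  have hderiv : ∀ t : ℝ, HasDerivAt (fun s : ℝ => f (xstar + s • h) - β / 2 * ‖h‖ ^ 2 * s ^ 2)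
      (inner ℝ (gradient f (xstar + t • h)) h - β * ‖h‖ ^ 2 * t) t := by
    intro t
    have h1 := (hasDerivAt_comp_line hs.1 xstar h t).sub
      (((hasDerivAt_pow 2 t)).const_mul (β / 2 * ‖h‖ ^ 2))
    refine h1.congr_deriv ?_
    norm_num
    ring
  have hanti : AntitoneOn (fun s : ℝ => f (xstar + s • h) - β / 2 * ‖h‖ ^ 2 * s ^ 2)
      (Set.Icc 0 1) := by
    refine antitoneOn_of_deriv_nonpos (convex_Icc 0 1)
      (fun t _ => (hderiv t).continuousAt.continuousWithinAt)
      (fun t _ => (hderiv t).differentiableAt.differentiableWithinAt) fun t ht => ?_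
    rw [interior_Icc] at ht
    rw [(hderiv t).deriv]
    have h1 := hs.2 (xstar + t • h) xstar
    rw [gradient_eq_zero_of_forall_le hmin, sub_zero, add_sub_cancel_left, norm_smul,
      Real.norm_of_nonneg ht.1.le] at h1
    have h2 := real_inner_le_norm (gradient f (xstar + t • h)) h
    have h3 := mul_le_mul_of_nonneg_right h1 (norm_nonneg h)
    linarith
  have h1 := hanti (Set.left_mem_Icc.2 zero_le_one) (Set.right_mem_Icc.2 zero_le_one) zero_le_one
  simp only [one_smul, zero_smul, add_zero] at h1
  rw [hh, add_sub_cancel] at h1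
  norm_num at h1
  linarith

lemma le_sub_of_strongConvexOn (hc : StrongConvexOn Set.univ α f) (hmin : ∀ y, f xstar ≤ f y)
    (x : Pt d) : α / 2 * ‖x - xstar‖ ^ 2 ≤ f x - f xstar := by
  by_contra hlt
  push Not at hlt
  set A := α / 2 * ‖x - xstar‖ ^ 2 with hA
  set D := f x - f xstar with hD
  have hD0 : 0 ≤ D := by have := hmin x; linarith
  have key : ∀ t : ℝ, 0 < t → t ≤ 1 → (1 - t) * A ≤ D := by
    intro t ht ht1
    have h1 := hc.2 (Set.mem_univ x) (Set.mem_univ xstar) ht.le (sub_nonneg.2 ht1) (by ring)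
    have h2 := hmin (t • x + (1 - t) • xstar)
    simp only [smul_eq_mul] at h1
    have h3 : t * ((1 - t) * A) ≤ t * D := by
      rw [hA, hD]; nlinarith
    exact le_of_mul_le_mul_left h3 ht
  have hApos : 0 < A := lt_of_le_of_lt hD0 hlt
  have := key ((A - D) / (2 * A)) (by apply div_pos <;> linarith)
    (by rw [div_le_one (by positivity)]; linarith)
  have h4 : (1 - (A - D) / (2 * A)) * A = (A + D) / 2 := by field_simp; ring
  linarith

/-- Lower bound for the cosine of the angle between the gradient and the direction from the
minimiser: the point `xstar + ρ g`, where `g` is the normalised gradient at `w` and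
`ρ = √(2 (f w - f xstar) / β)`, has value at most `f w`, so it lies in the half-space of the
supporting hyperplane at `w`. -/
lemma sqrt_mul_norm_gradient_le (hβ : 0 < β) (hconv : ConvexOn ℝ Set.univ f)
    (hs : IsSmoothFn β f) (hmin : ∀ y, f xstar ≤ f y) (w : Pt d) :
    Real.sqrt (2 * (f w - f xstar) / β) * ‖gradient f w‖ ≤
      inner ℝ (gradient f w) (w - xstar) := by
  set ρ := Real.sqrt (2 * (f w - f xstar) / β) with hρ
  have hΔ : 0 ≤ f w - f xstar := sub_nonneg.2 (hmin w)
  have hρ2 : ρ ^ 2 = 2 * (f w - f xstar) / β := Real.sq_sqrt (by positivity)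
  rcases eq_or_ne (gradient f w) 0 with h0 | h0
  · simp [h0]
  have hpos : 0 < ‖gradient f w‖ := norm_pos_iff.2 h0
  set y := xstar + (ρ * ‖gradient f w‖⁻¹) • gradient f w with hy
  have h1 := sub_le_of_isSmoothFn hs hmin y
  have h2 : ‖y - xstar‖ = ρ := by
    rw [hy, add_sub_cancel_left, norm_smul, norm_mul, norm_inv, norm_norm, mul_assoc,
      inv_mul_cancel₀ hpos.ne', mul_one, Real.norm_of_nonneg (Real.sqrt_nonneg _)]
  rw [h2, hρ2] at h1
  have h3 : β / 2 * (2 * (f w - f xstar) / β) = f w - f xstar := by field_simp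
  have h4 := add_inner_gradient_le hconv hs.1 w y
  have h5 : inner ℝ (gradient f w) (y - w) =
      ρ * ‖gradient f w‖ - inner ℝ (gradient f w) (w - xstar) := by
    rw [show y - w = (ρ * ‖gradient f w‖⁻¹) • gradient f w - (w - xstar) by rw [hy]; abel,
      inner_sub_right, inner_smul_right, real_inner_self_eq_norm_sq]
    field_simp
  linarith

lemma le_norm_gradient (hα : 0 < α) (hc : StrongConvexOn Set.univ α f)
    (hs : IsSmoothFn β f) (hmin : ∀ y, f xstar ≤ f y) (w : Pt d) :
    α / 2 * ‖w - xstar‖ ≤ ‖gradient f w‖ := by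
  have hconv : ConvexOn ℝ Set.univ f := (hc.strictConvexOn hα).convexOn
  have h1 := add_inner_gradient_le hconv hs.1 w xstar
  have h2 := le_sub_of_strongConvexOn hc hmin w
  have h3 := real_inner_le_norm (gradient f w) (w - xstar)
  rw [← neg_sub w xstar, inner_neg_right] at h1
  rcases eq_or_lt_of_le (norm_nonneg (w - xstar)) with h0 | h0
  · rw [← h0]; simp
  · refine le_of_mul_le_mul_right ?_ h0
    nlinarith

lemma abs_signVec {n : ℕ} (v : SignVec n) (i : Fin n) : |((v i : ℤ) : ℝ)| = 1 := by
  rcases Int.units_eq_one_or (v i) with h | h <;> simp [h]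

lemma norm_signVec_sum_le {n : ℕ} {r : ℝ} {u : Fin n → Pt d} (hu : ∀ i, ‖u i‖ = r)
    (v : SignVec n) : ‖∑ i, ((v i : ℤ) : ℝ) • u i‖ ≤ n * r := by
  refine (norm_sum_le _ _).trans ?_
  simp [norm_smul, hu, abs_signVec]

/-- The label of the winner gives the signs of the directional derivatives at `w`, except for
directions along which the derivative is at most `β γ`: flipping one sign of the label does not
decrease `f`. -/
lemma winner_mul_inner_gradient_le {n : ℕ} (hβ : 0 < β) (hconv : ConvexOn ℝ Set.univ f)
    (hs : IsSmoothFn β f) (O : WinnerFeedback n f) {γ r : ℝ} (hγ : 0 < γ) (hr : n * r ^ 2 = 1)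
    (w : Pt d) {u : Fin n → Pt d} (hu : ∀ i, ‖u i‖ = r) (i : Fin n) :
    ((O.winner (queryPoint γ w u) i : ℤ) : ℝ) * inner ℝ (gradient f w) (u i) ≤ β * γ := by
  set v := O.winner (queryPoint γ w u) with hv
  set p := queryPoint γ w u v with hp
  set v' : SignVec n := Function.update v i (-v i) with hv'
  set q := queryPoint γ w u v' with hq
  have hpq : p - q = (2 * γ * ((v i : ℤ) : ℝ)) • u i := by
    simp only [hp, hq, queryPoint, add_sub_add_left_eq_sub, ← smul_sub, ← Finset.sum_sub_distrib]
    rw [Finset.sum_eq_single i]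
    · simp only [hv', Function.update_self, ← sub_smul, smul_smul]
      congr 1; push_cast; ring
    · intro j _ hj
      simp [hv', Function.update_of_ne hj]
    · simp
  have h1 : f p ≤ f q := O.isArgmin (queryPoint γ w u) v'
  have h2 := add_inner_gradient_le hconv hs.1 q p
  have h3 : inner ℝ (gradient f w) (p - q) ≤ ‖gradient f w - gradient f q‖ * ‖p - q‖ := by
    have h4 := real_inner_le_norm (gradient f w - gradient f q) (p - q)
    rw [inner_sub_left] at h4
    linarith
  have h4 := hs.2 w q
  have h5 : ‖w - q‖ ≤ γ * (n * r) := by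
    rw [hq, queryPoint, sub_add_cancel_left, norm_neg, norm_smul, Real.norm_of_nonneg hγ.le]
    exact mul_le_mul_of_nonneg_left (norm_signVec_sum_le hu v') hγ.le
  have h6 : ‖p - q‖ = 2 * γ * r := by
    rw [hpq, norm_smul, hu, Real.norm_eq_abs, abs_mul, abs_signVec, abs_of_pos (by positivity)]
    ring
  have hr0 : 0 ≤ r := hu i ▸ norm_nonneg _
  have h7 : ‖gradient f w - gradient f q‖ * ‖p - q‖ ≤ (β * (γ * (n * r))) * (2 * γ * r) := by
    rw [h6]
    refine mul_le_mul_of_nonneg_right (h4.trans ?_) (by positivity)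
    gcongr
  have h8 : (β * (γ * (n * r))) * (2 * γ * r) = 2 * γ * (β * γ) := by
    linear_combination 2 * β * γ ^ 2 * hr
  have h9 := h3.trans (h7.trans_eq h8)
  rw [hpq, inner_smul_right] at h9
  refine le_of_mul_le_mul_left (a := 2 * γ) ?_ (by positivity)
  linarith

end Function

/-! ### One round of Battling-NGD -/

/-- One step of a perturbed gradient method, with the squared distance `Φ = ‖h‖ ^ 2` as potential.
If the mean decrease of the potential exceeds `a`, then the square of the potential plus the
accumulated decrease grows in mean by no more than the second moment of the step. -/
lemma lintegral_potential_step_le {Ω : Type*} [MeasurableSpace Ω] {P : Measure Ω}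
    [IsProbabilityMeasure P] {d : ℕ} {G : Ω → Pt d} {h : Pt d} {q S B a I : ℝ} {Φ' : Ω → ℝ}
    (hS : 0 ≤ S) (hB : 0 ≤ B) (ha : 0 ≤ a) (hq : 0 ≤ q)
    (hG1 : Integrable (fun ω => inner ℝ (G ω) h) P)
    (hG2 : Integrable (fun ω => ‖G ω‖ ^ 2) P) (hG4 : Integrable (fun ω => ‖G ω‖ ^ 4) P)
    (hΦ0 : ∀ ω, 0 ≤ Φ' ω)
    (hΦ : ∀ ω, Φ' ω ≤ ‖h‖ ^ 2 - 2 * q * inner ℝ (G ω) h + q ^ 2 * ‖G ω‖ ^ 2)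
    (hI : I ≤ ∫ ω, inner ℝ (G ω) h ∂P) (h2 : ∫ ω, ‖G ω‖ ^ 2 ∂P ≤ 9 / 2)
    (h4 : ∫ ω, ‖G ω‖ ^ 4 ∂P ≤ 1700)
    (hdrift : 9 / 2 * q ^ 2 + a ≤ 2 * q * I)
    (hvar : 18 * q ^ 2 * ‖h‖ ^ 2 + 1700 * q ^ 4 + a ^ 2 ≤ 27 * q ^ 2 * ‖h‖ ^ 2) :
    ∫⁻ ω, ENNReal.ofReal ((Φ' ω + S + a) ^ 2 + B * Φ' ω) ∂P ≤
      ENNReal.ofReal ((‖h‖ ^ 2 + S) ^ 2 + (81 * q ^ 2 + B) * ‖h‖ ^ 2) := by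
  set Φ := ‖h‖ ^ 2 with hΦdef
  have hΦpos : 0 ≤ Φ := by positivity
  -- the slope of `x ↦ (x + S) ^ 2 + B x` at `x = Φ`
  set M := 2 * (Φ + S) + B with hM
  have hM0 : 0 ≤ M := by positivity
  let R : Ω → ℝ := fun ω => ((Φ + S) ^ 2 + B * Φ + M * a + 3 * a ^ 2) +
    (-(2 * q * M)) * inner ℝ (G ω) h + (M * q ^ 2 + 12 * q ^ 2 * Φ) * ‖G ω‖ ^ 2 +
    3 * q ^ 4 * ‖G ω‖ ^ 4
  have hle : ∀ ω, (Φ' ω + S + a) ^ 2 + B * Φ' ω ≤ R ω := by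
    intro ω
    set ζ := - 2 * q * inner ℝ (G ω) h + q ^ 2 * ‖G ω‖ ^ 2 with hζ
    have h1 : Φ' ω ≤ Φ + ζ := by have := hΦ ω; linarith
    have h5 : (Φ' ω + S + a) ^ 2 ≤ (Φ + S + (ζ + a)) ^ 2 := by
      have := hΦ0 ω
      apply pow_le_pow_left₀ (by positivity); linarith
    have h6 : (inner ℝ (G ω) h) ^ 2 ≤ ‖G ω‖ ^ 2 * Φ := by
      rw [hΦdef, ← mul_pow, ← sq_abs]
      gcongr
      exact abs_real_inner_le_norm _ _
    have h7 : (ζ + a) ^ 2 ≤ 3 * (4 * q ^ 2 * (inner ℝ (G ω) h) ^ 2 + q ^ 4 * ‖G ω‖ ^ 4 + a ^ 2) := by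
      rw [hζ]
      nlinarith [sq_nonneg (-2 * q * inner ℝ (G ω) h - q ^ 2 * ‖G ω‖ ^ 2),
        sq_nonneg (-2 * q * inner ℝ (G ω) h - a), sq_nonneg (q ^ 2 * ‖G ω‖ ^ 2 - a)]
    have h8 := mul_le_mul_of_nonneg_left h6 (by positivity : 0 ≤ 12 * q ^ 2)
    have h9 := mul_le_mul_of_nonneg_left h1 hB
    have h10 : (Φ + S + (ζ + a)) ^ 2 + B * (Φ + ζ) + B * a =
        (Φ + S) ^ 2 + B * Φ + M * (ζ + a) + (ζ + a) ^ 2 := by rw [hM]; ring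
    have h11 : M * (ζ + a) = M * a + (-(2 * q * M)) * inner ℝ (G ω) h +
        M * q ^ 2 * ‖G ω‖ ^ 2 := by rw [hζ]; ring
    have h12 : 0 ≤ B * a := by positivity
    simp only [R]
    linarith
  have hR1 : Integrable (fun ω => ((Φ + S) ^ 2 + B * Φ + M * a + 3 * a ^ 2) +
    (-(2 * q * M)) * inner ℝ (G ω) h) P := (integrable_const _).add (hG1.const_mul _)
  have hR2 : Integrable (fun ω => ((Φ + S) ^ 2 + B * Φ + M * a + 3 * a ^ 2) +
    (-(2 * q * M)) * inner ℝ (G ω) h + (M * q ^ 2 + 12 * q ^ 2 * Φ) * ‖G ω‖ ^ 2) P :=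
    hR1.add (hG2.const_mul _)
  have hR : Integrable R P := hR2.add (hG4.const_mul _)
  have hRint : ∫ ω, R ω ∂P ≤ (Φ + S) ^ 2 + (81 * q ^ 2 + B) * Φ := by
    simp only [R]
    rw [integral_add hR2 (hG4.const_mul _), integral_add hR1 (hG2.const_mul _),
      integral_add (integrable_const _) (hG1.const_mul _), integral_const_mul, integral_const_mul,
      integral_const_mul]
    simp only [integral_const, probReal_univ, smul_eq_mul, one_mul]
    have e1 := mul_le_mul_of_nonneg_left hI (by positivity : 0 ≤ 2 * q * M)
    have e2 := mul_le_mul_of_nonneg_left h2 (by positivity : 0 ≤ M * q ^ 2 + 12 * q ^ 2 * Φ)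
    have e3 := mul_le_mul_of_nonneg_left h4 (by positivity : 0 ≤ 3 * q ^ 4)
    have e4 := mul_le_mul_of_nonneg_left hdrift hM0
    linarith
  calc ∫⁻ ω, ENNReal.ofReal ((Φ' ω + S + a) ^ 2 + B * Φ' ω) ∂P
      ≤ ∫⁻ ω, ENNReal.ofReal (R ω) ∂P :=
        lintegral_mono fun ω => ENNReal.ofReal_le_ofReal (hle ω)
    _ = ENNReal.ofReal (∫ ω, R ω ∂P) := by
        refine (ofReal_integral_eq_lintegral_ofReal hR (Filter.Eventually.of_forall fun ω => ?_)).symm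
        refine le_trans ?_ (hle ω)
        have := hΦ0 ω
        positivity
    _ ≤ _ := ENNReal.ofReal_le_ofReal hRint

section Round

variable {d n : ℕ} {f : Pt d → ℝ} {α β : ℝ} {xstar : Pt d} {K : Set (Pt d)}

/-- The point reached from `w` in a round with directions `u`. -/
noncomputable def nextPoint (K : Set (Pt d)) (O : WinnerFeedback n f) (η γ : ℝ)
    (u : Fin n → Pt d) (w : Pt d) : Pt d :=
  euclProj K (w - η • gradEstimate u (O.winner (queryPoint γ w u)))

lemma measurable_comp_winner {E F : Type*} [MeasurableSpace E] [TopologicalSpace F] [AddCommMonoid F]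
    [MeasurableSpace F] [ContinuousAdd F] [MeasurableAdd₂ F] (O : WinnerFeedback n f)
    {x : E → SignVec n → Pt d} (hx : Measurable x) {φ : E → SignVec n → F}
    (hφ : ∀ v, Measurable fun e => φ e v) : Measurable fun e => φ e (O.winner (x e)) := by
  classical
  have h : (fun e => φ e (O.winner (x e))) =
      fun e => ∑ v, (x ⁻¹' {x | O.winner x = v}).indicator (fun e => φ e v) e := by
    ext1 e
    rw [Finset.sum_eq_single (O.winner (x e))]
    · rw [Set.indicator_of_mem]; rfl
    · intro v _ hv
      exact Set.indicator_of_notMem (fun hmem => hv hmem.symm) _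
    · simp
  rw [h]
  exact Finset.measurable_sum _ fun v _ => (hφ v).indicator (hx (O.measurable v))

lemma measurable_queryPoint {E : Type*} [MeasurableSpace E] {γ : E → ℝ} {w : E → Pt d}
    {u : E → Fin n → Pt d} (hγ : Measurable γ) (hw : Measurable w) (hu : Measurable u) :
    Measurable fun e => queryPoint (γ e) (w e) (u e) := by
  refine measurable_pi_lambda _ fun v => ?_
  unfold queryPoint
  have : ∀ i, Measurable fun e => u e i := fun i => (measurable_pi_apply i).comp hu
  fun_prop

lemma measurable_nextPoint {E : Type*} [MeasurableSpace E] (hne : K.Nonempty) (hcl : IsClosed K)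
    (hconv : Convex ℝ K) (O : WinnerFeedback n f) {η γ : E → ℝ} (hη : Measurable η)
    (hγ : Measurable γ) {w : E → Pt d} {u : E → Fin n → Pt d} (hw : Measurable w)
    (hu : Measurable u) :
    Measurable fun e => nextPoint K O (η e) (γ e) (u e) (w e) := by
  have hg : Measurable fun e => gradEstimate (u e) (O.winner (queryPoint (γ e) (w e) (u e))) := by
    refine measurable_comp_winner O (measurable_queryPoint hγ hw hu)
      (φ := fun e v => gradEstimate (u e) v) fun v => ?_
    unfold gradEstimate
    have : ∀ i, Measurable fun e => u e i := fun i => (measurable_pi_apply i).comp hu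
    fun_prop
  exact (continuous_euclProj hne hcl hconv).measurable.comp (hw.sub (hη.smul hg))

lemma norm_nextPoint_sub_sq_le (hcl : IsClosed K) (hconv : Convex ℝ K) (hx : xstar ∈ K)
    (O : WinnerFeedback n f) (η γ : ℝ) (u : Fin n → Pt d) (w : Pt d) :
    ‖nextPoint K O η γ u w - xstar‖ ^ 2 ≤ ‖w - xstar‖ ^ 2 -
      2 * (η / n) * inner ℝ (∑ i, (-((O.winner (queryPoint γ w u) i : ℤ) : ℝ)) • u i) (w - xstar) +
      (η / n) ^ 2 * ‖∑ i, (-((O.winner (queryPoint γ w u) i : ℤ) : ℝ)) • u i‖ ^ 2 := by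
  set G := ∑ i, (-((O.winner (queryPoint γ w u) i : ℤ) : ℝ)) • u i with hG
  have h1 : ‖nextPoint K O η γ u w - xstar‖ ≤ ‖(w - xstar) - (η / n) • G‖ := by
    have h2 := norm_euclProj_sub_euclProj_le ⟨_, hx⟩ hcl hconv
      (w - η • gradEstimate u (O.winner (queryPoint γ w u))) xstar
    rw [euclProj_eq_self hcl hconv hx] at h2
    refine h2.trans (le_of_eq ?_)
    rw [gradEstimate, smul_smul, ← hG, div_eq_mul_inv]
    congr 1; abel
  calc ‖nextPoint K O η γ u w - xstar‖ ^ 2 ≤ ‖(w - xstar) - (η / n) • G‖ ^ 2 := by gcongr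
    _ = _ := by
      rw [norm_sub_sq_real, norm_smul, inner_smul_right, real_inner_comm, mul_pow,
        Real.norm_eq_abs, sq_abs]
      ring

lemma learningRate_div_sq (hn : 1 ≤ n) (hd : 1 ≤ d) (hβ : 0 < β) {e : ℝ} (he : 0 < e) :
    (learningRate d n β e / n) ^ 2 = n * e / (400 * (d * β)) := by
  have hn' : (0 : ℝ) < n := by exact_mod_cast hn
  have hd' : (0 : ℝ) < d := by exact_mod_cast hd
  unfold learningRate
  rw [div_pow, div_pow, mul_pow, mul_pow, mul_pow, Real.sq_sqrt hn'.le, Real.sq_sqrt he.le,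
    Real.sq_sqrt (by positivity)]
  field_simp; norm_num

lemma two_le_sqrt_log : 2 ≤ Real.sqrt (Real.log 480) := by
  apply Real.le_sqrt_of_sq_le
  rw [Real.le_log_iff_exp_le (by norm_num)]
  have h1 : Real.exp (2 ^ 2) = Real.exp 1 ^ 4 := by
    rw [← Real.exp_nat_mul]; norm_num
  rw [h1]
  calc Real.exp 1 ^ 4 ≤ 3 ^ 4 := by gcongr; linarith [Real.exp_one_lt_d9]
    _ ≤ 480 := by norm_num

lemma perturbation_pos (hn : 1 ≤ n) (hd : 1 ≤ d) (hα : 0 < α) (hβ : 0 < β) {e : ℝ}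
    (he : 0 < e) : 0 < perturbation d n α β e := by
  have hn' : (0 : ℝ) < n := by exact_mod_cast hn
  have hd' : (0 : ℝ) < d := by exact_mod_cast hd
  have := two_le_sqrt_log
  unfold perturbation
  positivity

lemma perturbation_le (hn : 1 ≤ n) (hd : 1 ≤ d) (hα : 0 < α) (hβ : 0 < β) (e : ℝ) :
    perturbation d n α β e ≤
      α / (1920 * β * (d * n)) * (1 / (Real.sqrt d * Real.sqrt n)) * Real.sqrt (2 * e / β) := by
  have hn' : (0 : ℝ) < n := by exact_mod_cast hn
  have hd' : (0 : ℝ) < d := by exact_mod_cast hd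
  have h2 := two_le_sqrt_log
  unfold perturbation
  refine mul_le_mul_of_nonneg_right ?_ (Real.sqrt_nonneg _)
  rw [div_mul_div_comm, mul_one, Real.sqrt_mul hd'.le]
  refine div_le_div_of_nonneg_left hα.le (by positivity) ?_
  have h3 : 0 ≤ 960 * β * d * n * (Real.sqrt d * Real.sqrt n) := by positivity
  nlinarith [mul_le_mul_of_nonneg_left h2 h3]

variable {Ω : Type*} [MeasurableSpace Ω] {P : Measure Ω}

/-- The signs derived from the winner's label at `w` satisfy the hypotheses on signed directions
with `g` the normalised gradient at `w`. The small-ball probability `p` is so small because the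
perturbation is: the gradient has norm at least `α ‖w - xstar‖ / 2`. -/
lemma signedDirections_winner (hn : 1 ≤ n) (hnd : n ≤ d) (hα : 0 < α) (hβ : 0 < β)
    (hc : StrongConvexOn Set.univ α f) (hs : IsSmoothFn β f) (hmin : ∀ y, f xstar ≤ f y)
    (O : WinnerFeedback n f) {e : ℝ} (he : 0 < e) {w : Pt d} (hw : e / 4 < f w - f xstar)
    {u : Fin n → Ω → Pt d} (hmeas : ∀ i, Measurable (u i))
    (hlaw : ∀ i, HasLaw (u i) (uniformSphere d (1 / Real.sqrt n)) P) (hindep : iIndepFun u P) :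
    ∃ p : ℝ, p * ‖w - xstar‖ ≤ Real.sqrt (2 * e / β) / (56 * (d * n)) ∧
      SignedDirections P (1 / Real.sqrt n) (β * perturbation d n α β e / ‖gradient f w‖) p
        (‖gradient f w‖⁻¹ • gradient f w) u
        (fun i ω => -((O.winner (queryPoint (perturbation d n α β e) w (fun i => u i ω)) i : ℤ) : ℝ)) := by
  have hd : 1 ≤ d := hn.trans hnd
  have hn' : (0 : ℝ) < n := by exact_mod_cast hn
  have hd' : (0 : ℝ) < d := by exact_mod_cast hd
  have hconv : ConvexOn ℝ Set.univ f := (hc.strictConvexOn hα).convexOn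
  set γ := perturbation d n α β e with hγ
  have hγ0 : 0 < γ := perturbation_pos hn hd hα hβ he
  set R := ‖w - xstar‖ with hR
  set re := Real.sqrt (2 * e / β) with hre
  have hre0 : 0 < re := Real.sqrt_pos.2 (by positivity)
  have hreR : re ≤ 2 * R := by
    have h1 := sub_le_of_isSmoothFn hs hmin w
    have h2 : re ^ 2 ≤ (2 * R) ^ 2 := by
      rw [hre, Real.sq_sqrt (by positivity), div_le_iff₀ hβ]
      nlinarith
    exact (pow_le_pow_iff_left₀ hre0.le (by positivity) two_ne_zero).1 h2
  have hR0 : 0 < R := by linarith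
  have hN := le_norm_gradient hα hc hs hmin w
  set N := ‖gradient f w‖ with hNdef
  have hN0 : 0 < N := lt_of_lt_of_le (by positivity) hN
  set r := 1 / Real.sqrt n with hr
  have hsn : 0 < Real.sqrt n := Real.sqrt_pos.2 hn'
  have hsd : 0 < Real.sqrt d := Real.sqrt_pos.2 hd'
  have hr0 : 0 < r := by positivity
  have hnr : n * r ^ 2 = 1 := by
    rw [hr, div_pow, Real.sq_sqrt hn'.le]; field_simp
  have hg : ‖N⁻¹ • gradient f w‖ = 1 := by
    rw [norm_smul, norm_inv, hNdef, norm_norm, inv_mul_cancel₀ hN0.ne']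
  set t := β * γ / N with ht
  have ht0 : 0 < t := by positivity
  set p := 17 * Real.sqrt d * (t / r) with hp
  have hpR : p * R ≤ re / (56 * (d * n)) := by
    have h1 := perturbation_le hn hd hα hβ e
    rw [← hγ, ← hre] at h1
    have h2 : t ≤ β * (α / (1920 * β * (d * n)) * (1 / (Real.sqrt d * Real.sqrt n)) * re) /
        (α / 2 * R) := by
      rw [ht]; gcongr
    have h3 : p * R ≤ 17 * Real.sqrt d * (β * (α / (1920 * β * (d * n)) *
        (1 / (Real.sqrt d * Real.sqrt n)) * re) / (α / 2 * R) / r) * R := by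
      rw [hp]; gcongr
    have h4 : 17 * Real.sqrt d * (β * (α / (1920 * β * (d * n)) *
        (1 / (Real.sqrt d * Real.sqrt n)) * re) / (α / 2 * R) / r) * R =
        17 / 960 * (re / (d * n)) := by
      rw [hr]; field_simp; norm_num
    rw [h4] at h3
    refine h3.trans ?_
    have h5 : re / (56 * (d * n)) = 1 / 56 * (re / (d * n)) := by field_simp
    rw [h5]
    exact mul_le_mul_of_nonneg_right (by norm_num) (by positivity)
  refine ⟨p, hpR, ⟨hn, hnd, hr0, hnr, hg, hmeas, hlaw, hindep, ?_, ?_, ?_, ?_, ?_⟩⟩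
  · intro i
    refine measurable_comp_winner O (x := fun ω => queryPoint γ w (fun i => u i ω))
      (φ := fun _ v => -((v i : ℤ) : ℝ)) ?_ fun v => measurable_const
    exact measurable_queryPoint measurable_const measurable_const (measurable_pi_lambda _ hmeas)
  · intro i ω
    rw [abs_neg, abs_signVec]
  · filter_upwards [ae_norm_eq_of_hasLaw hr0.le hlaw] with ω hω i hi
    have h1 := winner_mul_inner_gradient_le hβ hconv hs O hγ0 hnr w hω i
    have h2 : inner ℝ (gradient f w) (u i ω) = N * inner ℝ (u i ω) (N⁻¹ • gradient f w) := by
      rw [inner_smul_right, real_inner_comm]; field_simp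
    rw [h2, mul_left_comm, mul_comm N, ← le_div_iff₀ hN0, ← ht] at h1
    rcases Int.units_eq_one_or (O.winner (queryPoint γ w (fun i => u i ω)) i) with h | h
    · rw [h] at h1 ⊢
      simp only [Units.val_one, Int.cast_one, one_mul] at h1 ⊢
      rcases lt_abs.1 hi with h3 | h3
      · linarith
      · rw [signOne, if_neg (by linarith)]
    · rw [h] at h1 ⊢
      simp only [Units.val_neg, Units.val_one, Int.cast_neg, Int.cast_one, neg_mul, one_mul,
        neg_neg] at h1 ⊢
      rcases lt_abs.1 hi with h3 | h3
      · rw [signOne, if_pos (by linarith)]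
      · linarith
  · have h1 := uniformSphere_slab_le hd hr0 hg (δ := t / r) (by positivity)
    rwa [mul_div_cancel₀ t hr0.ne'] at h1
  · have h1 : p * R ≤ 1 / (28 * (d * n)) * R := by
      refine hpR.trans ?_
      rw [div_le_iff₀ (by positivity)]
      have : 1 / (28 * (d * n)) * R * (56 * (d * n)) = 2 * R := by field_simp; norm_num
      rw [this]; exact hreR
    exact le_of_mul_le_mul_right h1 hR0

/-- The per-round drift `18 Q √(Δ / e)` of the squared distance, `Δ` the suboptimality of the
current point and `e` the target accuracy. -/
noncomputable def roundDrift (d n : ℕ) (β e Δ : ℝ) : ℝ :=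
  18 * (n * e / (400 * (d * β))) * Real.sqrt (Δ / e)

lemma roundDrift_nonneg (hβ : 0 < β) {e : ℝ} (he : 0 < e) (Δ : ℝ) :
    0 ≤ roundDrift d n β e Δ := by
  unfold roundDrift; positivity

/-- The mean first-order decrease of the squared distance, expressed through the drift. -/
lemma mul_sqrt_le_mul_sqrt (hn : 1 ≤ n) (hd : 1 ≤ d) (hβ : 0 < β) {e Δ q : ℝ} (he : 0 < e)
    (hΔ : 0 < Δ) (hq : 0 ≤ q) (hQ : q ^ 2 = n * e / (400 * (d * β))) :
    28 * (n * e / (400 * (d * β))) * Real.sqrt (Δ / e) ≤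
      q * (Real.sqrt n / Real.sqrt d * Real.sqrt (2 * Δ / β)) := by
  have hn' : (0 : ℝ) < n := by exact_mod_cast hn
  have hd' : (0 : ℝ) < d := by exact_mod_cast hd
  have h2 : (q * (Real.sqrt n / Real.sqrt d * Real.sqrt (2 * Δ / β))) ^ 2 =
      800 * ((n * e / (400 * (d * β))) ^ 2 * (Δ / e)) := by
    rw [mul_pow, mul_pow, div_pow, Real.sq_sqrt hn'.le, Real.sq_sqrt hd'.le,
      Real.sq_sqrt (by positivity), hQ]
    field_simp; norm_num
  refine (pow_le_pow_iff_left₀ (by positivity) (by positivity) two_ne_zero).1 ?_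
  rw [h2, mul_pow, mul_pow, Real.sq_sqrt (by positivity)]
  have : 0 ≤ (n * e / (400 * (d * β))) ^ 2 * (Δ / e) := by positivity
  linarith

/-- The variance hypothesis of `lintegral_potential_step_le` holds for the drift `roundDrift`, since
the suboptimality and the accuracy are at most of the order of `β` times the squared distance. -/
lemma second_moment_le (hn : 1 ≤ n) (hnd : n ≤ d) (hβ : 0 < β) {e Δ Φ : ℝ} (he : 0 < e)
    (heΔ : e / 4 < Δ) (hΔ : Δ ≤ β / 2 * Φ) :
    18 * (n * e / (400 * (d * β))) * Φ + 1700 * (n * e / (400 * (d * β))) ^ 2 +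
      roundDrift d n β e Δ ^ 2 ≤ 27 * (n * e / (400 * (d * β))) * Φ := by
  have hn' : (1 : ℝ) ≤ n := by exact_mod_cast hn
  have hnd' : (n : ℝ) ≤ d := by exact_mod_cast hnd
  have hd' : (1 : ℝ) ≤ d := hn'.trans hnd'
  have hΔ0 : 0 < Δ := by linarith
  unfold roundDrift
  set Q := n * e / (400 * (d * β)) with hQdef
  have hQ0 : 0 < Q := by positivity
  have hQn : Q ≤ e / (400 * β) := by
    rw [hQdef, div_le_div_iff₀ (by positivity) (by positivity)]
    have : n * (e * (400 * β)) ≤ d * (e * (400 * β)) := by gcongr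
    linarith
  have hQΦ : Q ≤ Φ / 200 := by
    refine hQn.trans ?_
    rw [div_le_div_iff₀ (by positivity) (by norm_num)]
    linarith
  have hQΔ : Q * (Δ / e) ≤ Φ / 800 := by
    calc Q * (Δ / e) ≤ e / (400 * β) * (Δ / e) := by gcongr
      _ = Δ / (400 * β) := by field_simp
      _ ≤ _ := by
        rw [div_le_div_iff₀ (by positivity) (by norm_num)]
        linarith
  have h1 := mul_le_mul_of_nonneg_left hQΦ hQ0.le
  have h2 := mul_le_mul_of_nonneg_left hQΔ hQ0.le
  have h3 : (18 * Q * Real.sqrt (Δ / e)) ^ 2 = 324 * (Q * (Q * (Δ / e))) := by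
    rw [mul_pow, Real.sq_sqrt (by positivity)]; ring
  have h4 : 0 ≤ Q * Φ := mul_nonneg hQ0.le (by linarith)
  rw [h3]
  linarith

/-- One round started at a point whose suboptimality exceeds `e / 4`: the winner's signs satisfy the
moment bounds that `lintegral_potential_step_le` asks for, with `roundDrift` as the decrease. -/
lemma lintegral_nextPoint_le [IsProbabilityMeasure P] (hn : 1 ≤ n) (hnd : n ≤ d) (hα : 0 < α)
    (hβ : 0 < β)
    (hc : StrongConvexOn Set.univ α f) (hs : IsSmoothFn β f)
    (hcl : IsClosed K) (hK : Convex ℝ K) (hx : xstar ∈ K) (hmin : ∀ y, f xstar ≤ f y)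
    (O : WinnerFeedback n f) {e : ℝ} (he : 0 < e) {w : Pt d} (hw : e / 4 < f w - f xstar)
    {u : Fin n → Ω → Pt d} (hmeas : ∀ i, Measurable (u i))
    (hlaw : ∀ i, HasLaw (u i) (uniformSphere d (1 / Real.sqrt n)) P) (hindep : iIndepFun u P)
    {S B : ℝ} (hS : 0 ≤ S) (hB : 0 ≤ B) :
    ∫⁻ ω, ENNReal.ofReal ((‖nextPoint K O (learningRate d n β e) (perturbation d n α β e)
        (fun i => u i ω) w - xstar‖ ^ 2 + S + roundDrift d n β e (f w - f xstar)) ^ 2 +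
        B * ‖nextPoint K O (learningRate d n β e) (perturbation d n α β e)
        (fun i => u i ω) w - xstar‖ ^ 2) ∂P ≤
      ENNReal.ofReal ((‖w - xstar‖ ^ 2 + S) ^ 2 +
        (81 * (n * e / (400 * (d * β))) + B) * ‖w - xstar‖ ^ 2) := by
  have hd : 1 ≤ d := hn.trans hnd
  have hn' : (1 : ℝ) ≤ n := by exact_mod_cast hn
  have hd' : (1 : ℝ) ≤ d := by exact_mod_cast hd
  have hconv : ConvexOn ℝ Set.univ f := (hc.strictConvexOn hα).convexOn
  obtain ⟨p, hpR, hsd⟩ := signedDirections_winner hn hnd hα hβ hc hs hmin O he hw hmeas hlaw hindep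
  set γ := perturbation d n α β e with hγ
  have hstep1 := fun ω => norm_nextPoint_sub_sq_le hcl hK hx O (learningRate d n β e) γ
    (fun i => u i ω) w
  set Δ := f w - f xstar with hΔ
  have hΔ0 : 0 < Δ := by linarith
  have hQ := learningRate_div_sq hn hd hβ he
  have hq0 : 0 ≤ learningRate d n β e / n := by unfold learningRate; positivity
  generalize learningRate d n β e / n = q at hQ hq0 hstep1
  have hkey := mul_sqrt_le_mul_sqrt hn hd hβ he hΔ0 hq0 hQ
  have hvar := second_moment_le hn hnd hβ he hw (sub_le_of_isSmoothFn hs hmin w)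
  set Q := n * e / (400 * (d * β)) with hQdef
  have hQ0 : 0 < Q := by positivity
  have hyhalf : 1 / 2 ≤ Real.sqrt (Δ / e) := by
    apply Real.le_sqrt_of_sq_le
    rw [le_div_iff₀ he]; linarith
  have hre2 : Real.sqrt (2 * e / β) ≤ 2 * Real.sqrt (2 * Δ / β) := by
    refine Real.sqrt_le_iff.2 ⟨by positivity, ?_⟩
    rw [mul_pow, Real.sq_sqrt (by positivity),
      show (2 : ℝ) ^ 2 * (2 * Δ / β) = 2 * (4 * Δ) / β by ring]
    gcongr; linarith
  have hgrad := sqrt_mul_norm_gradient_le hβ hconv hs hmin w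
  rw [← hΔ] at hgrad
  set ρ := Real.sqrt (2 * Δ / β) with hρ
  have hρ0 : 0 < ρ := Real.sqrt_pos.2 (by positivity)
  have hN0 : 0 < ‖gradient f w‖ := by
    by_contra h
    have h0 : ‖gradient f w‖ = 0 := le_antisymm (not_lt.1 h) (norm_nonneg _)
    have := hsd.norm_g
    rw [norm_smul, h0, mul_zero] at this
    exact zero_ne_one this
  have hgw : ρ ≤ inner ℝ (‖gradient f w‖⁻¹ • gradient f w) (w - xstar) := by
    rw [inner_smul_left]
    simp only [conj_trivial]
    rw [inv_mul_eq_div, le_div_iff₀ hN0]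
    exact hgrad
  set V : Fin n → Ω → ℝ :=
    fun i ω => -((O.winner (queryPoint γ w (fun i => u i ω)) i : ℤ) : ℝ) with hV
  -- `55 / 112 = 9 / 16 - 2 * 2 / 56`: the first absolute moment less the loss by wrong signs
  have hI : 55 / 112 * (Real.sqrt n / Real.sqrt d * ρ) ≤
      ∫ ω, inner ℝ (∑ i, V i ω • u i ω) (w - xstar) ∂P := by
    refine le_trans ?_ (hsd.le_integral_inner (w - xstar))
    have h1 := le_integral_abs_inner_uniformSphere hd hsd.r_pos hsd.norm_g
    set sn := Real.sqrt n with hsn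
    set sd := Real.sqrt d with hsdd
    have hsn2 : sn ^ 2 = n := Real.sq_sqrt (by positivity)
    have hsd2 : sd ^ 2 = d := Real.sq_sqrt (by positivity)
    have hsn0 : 0 < sn := Real.sqrt_pos.2 (by positivity)
    have hsd0 : 0 < sd := Real.sqrt_pos.2 (by positivity)
    have hsd1 : 1 ≤ sd := Real.one_le_sqrt.2 hd'
    set c := ∫ x, |inner ℝ x (‖gradient f w‖⁻¹ • gradient f w)| ∂(uniformSphere d (1 / sn))
    have h2 : 9 / 16 * (1 / sn / sd) * ρ ≤
        c * inner ℝ (‖gradient f w‖⁻¹ • gradient f w) (w - xstar) :=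
      mul_le_mul h1 hgw hρ0.le (le_trans (by positivity) h1)
    have h3 : 2 * (1 / sn) * ‖w - xstar‖ * p ≤ 2 * (1 / sn) * (2 * ρ / (56 * sd)) := by
      have h4 : p * ‖w - xstar‖ ≤ 2 * ρ / (56 * sd) := by
        refine hpR.trans ?_
        have h5 : sd ≤ d * n := by nlinarith
        gcongr
      calc 2 * (1 / sn) * ‖w - xstar‖ * p = 2 * (1 / sn) * (p * ‖w - xstar‖) := by ring
        _ ≤ _ := by gcongr
    have h5 : 55 / 112 * (sn / sd * ρ) =
        n * (9 / 16 * (1 / sn / sd) * ρ - 2 * (1 / sn) * (2 * ρ / (56 * sd))) := by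
      rw [← hsn2]; field_simp; norm_num
    rw [h5]
    exact mul_le_mul_of_nonneg_left (sub_le_sub h2 h3) (by positivity)
  have hstep := lintegral_potential_step_le (P := P) (q := q) (S := S) (B := B)
    (G := fun ω => ∑ i, V i ω • u i ω)
    (a := roundDrift d n β e Δ) (h := w - xstar)
    (Φ' := fun ω => ‖nextPoint K O (learningRate d n β e) γ (fun i => u i ω) w - xstar‖ ^ 2)
    hS hB (roundDrift_nonneg hβ he _) hq0 (hsd.integrable_inner _)
    (hsd.integrable_norm_pow 2) (hsd.integrable_norm_pow 4) (fun ω => by positivity)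
    hstep1 hI hsd.integral_norm_sq_le hsd.integral_norm_pow_four_le ?_ ?_
  · rwa [hQ] at hstep
  · rw [roundDrift, ← hQdef, hQ]
    have : 9 / 2 * Q ≤ 9 * Q * Real.sqrt (Δ / e) := by nlinarith
    have h0 : 0 ≤ Q * Real.sqrt (Δ / e) := by positivity
    linarith
  · rw [show q ^ 4 = (q ^ 2) ^ 2 by ring, hQ]
    exact hvar

end Round

/-! ### Battling-NGD -/

section Deterministic

variable {d n : ℕ} {f : Pt d → ℝ} {K : Set (Pt d)} {O : WinnerFeedback n f} {η γ : ℝ}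
  {u : ℕ → Fin n → Pt d} {w : Pt d}

lemma battlingNGD_queries (t : ℕ) : (battlingNGD K O η γ u w t).queries = 2 * t := by
  induction t with
  | zero => rfl
  | succ t ih => simp only [battlingNGD, battlingRound, ih]; ring

lemma battlingNGD_best_succ (t : ℕ) : (battlingNGD K O η γ u w (t + 1)).best =
    if f (battlingNGD K O η γ u w t).best < f (battlingNGD K O η γ u w (t + 1)).current
    then (battlingNGD K O η γ u w t).best else (battlingNGD K O η γ u w (t + 1)).current := by
  have key : ∀ a b : ℝ, ((if b ≤ a then (1 : ℝ) else -1) < 0) ↔ a < b := by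
    intro a b
    split_ifs with h
    · exact ⟨fun h1 => absurd h1 (by norm_num), fun h1 => absurd h (not_le.2 h1)⟩
    · simpa using h
  simp only [battlingNGD, battlingRound, signFeedback, sub_nonneg, key]

lemma battlingNGD_mem (hne : K.Nonempty) (hcl : IsClosed K) (hK : Convex ℝ K) (hw : w ∈ K)
    (t : ℕ) : (battlingNGD K O η γ u w t).best ∈ K := by
  induction t with
  | zero => exact hw
  | succ t ih =>
    rw [battlingNGD_best_succ]
    split_ifs
    · exact ih
    · exact (euclProj_spec hne hcl hK _).1

lemma battlingNGD_best_le {s t : ℕ} (hst : s ≤ t) :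
    f (battlingNGD K O η γ u w t).best ≤ f (battlingNGD K O η γ u w s).current := by
  induction t with
  | zero =>
    obtain rfl : s = 0 := by omega
    exact le_rfl
  | succ t ih =>
    rw [battlingNGD_best_succ]
    rcases hst.lt_or_eq with h | rfl
    · have h1 := ih (by omega)
      split_ifs with h2
      · exact h1
      · exact (not_lt.1 h2).trans h1
    · split_ifs with h2
      · exact h2.le
      · exact le_rfl

end Deterministic

section Measurability

variable {d n : ℕ} {f : Pt d → ℝ} {K : Set (Pt d)} {E : Type*} [MeasurableSpace E]

lemma measurable_battlingNGD_current (hne : K.Nonempty) (hcl : IsClosed K) (hK : Convex ℝ K)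
    (O : WinnerFeedback n f) {η γ : E → ℝ} (hη : Measurable η) (hγ : Measurable γ)
    {w : E → Pt d} (hw : Measurable w) {u : E → ℕ → Fin n → Pt d} (t : ℕ)
    (hu : ∀ s < t, Measurable fun x => u x s) :
    Measurable fun x => (battlingNGD K O (η x) (γ x) (u x) (w x) t).current := by
  induction t with
  | zero => exact hw
  | succ t ih =>
    exact measurable_nextPoint hne hcl hK O hη hγ (ih fun s hs => hu s (by omega)) (hu t (by omega))

lemma measurable_battlingNGD_best (hf : Measurable f) (hne : K.Nonempty) (hcl : IsClosed K)
    (hK : Convex ℝ K) (O : WinnerFeedback n f) {η γ : E → ℝ} (hη : Measurable η)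
    (hγ : Measurable γ) {w : E → Pt d} (hw : Measurable w) {u : E → ℕ → Fin n → Pt d} (t : ℕ)
    (hu : ∀ s < t, Measurable fun x => u x s) :
    Measurable fun x => (battlingNGD K O (η x) (γ x) (u x) (w x) t).best := by
  induction t with
  | zero => exact hw
  | succ t ih =>
    have h1 := ih fun s hs => hu s (by omega)
    have h2 := measurable_battlingNGD_current hne hcl hK O hη hγ hw (t + 1) hu
    simp only [battlingNGD_best_succ]
    exact Measurable.ite (measurableSet_lt (hf.comp h1) (hf.comp h2)) h1 h2

end Measurability

/-- The σ-algebra generated by the members of the family `u` with index in `S`. -/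
abbrev subfamilySigma {Ω ι F : Type*} [MeasurableSpace F] (u : ι → Ω → F) (S : Set ι) :
    MeasurableSpace Ω :=
  ⨆ i ∈ S, MeasurableSpace.comap (u i) inferInstance

lemma subfamilySigma_le {Ω ι F : Type*} [mΩ : MeasurableSpace Ω] [MeasurableSpace F]
    {u : ι → Ω → F} (hu : ∀ i, Measurable (u i)) (S : Set ι) : subfamilySigma u S ≤ mΩ :=
  iSup₂_le fun i _ => (hu i).comap_le

lemma measurable_subfamilySigma {Ω ι F : Type*} [mF : MeasurableSpace F] (u : ι → Ω → F)
    {S : Set ι} {i : ι} (hi : i ∈ S) : Measurable[subfamilySigma u S] (u i) :=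
  (comap_measurable (u i)).mono (le_iSup₂ (f := fun i (_ : i ∈ S) => mF.comap (u i)) i hi) le_rfl

/-- Random variables measurable with respect to disjoint subfamilies of an independent family are
independent. -/
lemma ProbabilityTheory.iIndepFun.indepFun_of_subfamilySigma {Ω ι F F₁ F₂ : Type*}
    [MeasurableSpace Ω] [MeasurableSpace F] [MeasurableSpace F₁] [MeasurableSpace F₂]
    {P : Measure Ω} {u : ι → Ω → F} (hindep : iIndepFun u P) (hu : ∀ i, Measurable (u i))
    {S T : Set ι} (hST : Disjoint S T) {X : Ω → F₁} {Y : Ω → F₂}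
    (hX : Measurable[subfamilySigma u S] X) (hY : Measurable[subfamilySigma u T] Y) :
    IndepFun X Y P := by
  have h := indep_iSup_of_disjoint (fun i => (hu i).comap_le) hindep hST
  exact indep_of_indep_of_le_left (indep_of_indep_of_le_right h hY.comap_le) hX.comap_le

section Phase

variable {d n : ℕ} {f : Pt d → ℝ} {α β : ℝ} {xstar : Pt d} {K : Set (Pt d)}
  {Ω : Type*} [MeasurableSpace Ω] {P : Measure Ω}

/-- The indicator of the event that the points `c 0, …, c (t - 1)` all have suboptimality greater
than `e / 4`. -/
noncomputable def notHit (f : Pt d → ℝ) (xstar : Pt d) (e : ℝ) (c : ℕ → Pt d) (t : ℕ) : ENNReal :=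
  ∏ s ∈ Finset.range t, {w | e / 4 < f w - f xstar}.indicator 1 (c s)

/-- The drift accumulated along the points `c 0, …, c (t - 1)`. -/
noncomputable def accDrift (n : ℕ) (β : ℝ) (f : Pt d → ℝ) (xstar : Pt d) (e : ℝ) (c : ℕ → Pt d)
    (t : ℕ) : ℝ :=
  ∑ s ∈ Finset.range t, roundDrift d n β e (f (c s) - f xstar)

/-- The potential of a phase of `T` rounds after `t` of them: the square of the squared distance
plus the accumulated drift, with a compensator for the second moments of the remaining rounds,
as long as no point of suboptimality at most `e / 4` has been met. The
compensator is linear in the current squared distance, since so is the second moment of a step. -/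
noncomputable def phasePotential (n : ℕ) (β : ℝ) (f : Pt d → ℝ) (xstar : Pt d) (e : ℝ) (T : ℕ)
    (c : ℕ → Pt d) (t : ℕ) : ENNReal :=
  notHit f xstar e c t * ENNReal.ofReal ((‖c t - xstar‖ ^ 2 + accDrift n β f xstar e c t) ^ 2 +
    81 * (n * e / (400 * (d * β))) * (T - t) * ‖c t - xstar‖ ^ 2)

lemma accDrift_nonneg (hβ : 0 < β) {e : ℝ} (he : 0 < e) (c : ℕ → Pt d) (t : ℕ) :
    0 ≤ accDrift n β f xstar e c t :=
  Finset.sum_nonneg fun _ _ => roundDrift_nonneg hβ he _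

lemma notHit_ne_top {e : ℝ} (c : ℕ → Pt d) (t : ℕ) : notHit f xstar e c t ≠ ⊤ :=
  ENNReal.prod_ne_top fun s _ => by rw [Set.indicator_apply]; split_ifs <;> simp

/-- The potential is a supermartingale: average over the directions of round `t`, which are
independent of the state at its beginning. -/
lemma lintegral_phasePotential_succ_le [IsProbabilityMeasure P] (hn : 1 ≤ n) (hnd : n ≤ d)
    (hα : 0 < α) (hβ : 0 < β)
    (hc : StrongConvexOn Set.univ α f) (hs : IsSmoothFn β f)
    (hcl : IsClosed K) (hK : Convex ℝ K) (hx : xstar ∈ K) (hmin : ∀ y, f xstar ≤ f y)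
    (O : WinnerFeedback n f) {e : ℝ} (he : 0 < e)
    {u : ℕ → Fin n → Ω → Pt d} (hmeas : ∀ t i, Measurable (u t i))
    (hlaw : ∀ t i, HasLaw (u t i) (uniformSphere d (1 / Real.sqrt n)) P)
    (hindep : iIndepFun (fun p : ℕ × Fin n => u p.1 p.2) P) (w : Pt d) {t T : ℕ} (htT : t < T) :
    ∫⁻ ω, phasePotential n β f xstar e T (fun s => (battlingNGD K O (learningRate d n β e)
        (perturbation d n α β e) (fun t i => u t i ω) w s).current) (t + 1) ∂P ≤
      ∫⁻ ω, phasePotential n β f xstar e T (fun s => (battlingNGD K O (learningRate d n β e)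
        (perturbation d n α β e) (fun t i => u t i ω) w s).current) t ∂P := by
  set η := learningRate d n β e
  set γ := perturbation d n α β e
  set Q := n * e / (400 * (d * β)) with hQ
  have hf : Measurable f := hs.1.continuous.measurable
  have hne : K.Nonempty := ⟨_, hx⟩
  let c : Ω → ℕ → Pt d := fun ω s => (battlingNGD K O η γ (fun t i => u t i ω) w s).current
  let Y : Ω → Fin n → Pt d := fun ω i => u t i ω
  let X : Ω → Pt d × ℝ × ENNReal := fun ω =>
    (c ω t, accDrift n β f xstar e (c ω) t, notHit f xstar e (c ω) t)
  have hset : MeasurableSet {w | e / 4 < f w - f xstar} :=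
    measurableSet_lt measurable_const (hf.sub_const _)
  have hdrift : Measurable fun w => roundDrift d n β e (f w - f xstar) := by
    unfold roundDrift; fun_prop
  let φ : Pt d × ℝ × ENNReal → (Fin n → Pt d) → ENNReal := fun x y =>
    x.2.2 * {w | e / 4 < f w - f xstar}.indicator 1 x.1 *
      ENNReal.ofReal ((‖nextPoint K O η γ y x.1 - xstar‖ ^ 2 + x.2.1 +
        roundDrift d n β e (f x.1 - f xstar)) ^ 2 +
        81 * Q * (T - (t + 1)) * ‖nextPoint K O η γ y x.1 - xstar‖ ^ 2)
  have hφ : Measurable (Function.uncurry φ) := by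
    have h1 : Measurable fun z : (Pt d × ℝ × ENNReal) × (Fin n → Pt d) =>
        nextPoint K O η γ z.2 z.1.1 :=
      measurable_nextPoint hne hcl hK O measurable_const measurable_const
        (by fun_prop) (by fun_prop)
    have h2 : Measurable fun z : (Pt d × ℝ × ENNReal) × (Fin n → Pt d) =>
        {w | e / 4 < f w - f xstar}.indicator (1 : Pt d → ENNReal) z.1.1 :=
      (measurable_one.indicator hset).comp (by fun_prop)
    have h3 : Measurable fun z : (Pt d × ℝ × ENNReal) × (Fin n → Pt d) =>
        roundDrift d n β e (f z.1.1 - f xstar) := hdrift.comp (by fun_prop)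
    simp only [φ, Function.uncurry_def]
    fun_prop
  -- the state after `t` rounds depends on the directions sampled in the first `t` rounds only
  let U : ℕ × Fin n → Ω → Pt d := fun p => u p.1 p.2
  have hU : ∀ p, Measurable (U p) := fun p => hmeas p.1 p.2
  have hXm : Measurable[subfamilySigma U {p | p.1 < t}] X := by
    let _ : MeasurableSpace Ω := subfamilySigma U {p | p.1 < t}
    have h1 : ∀ s ≤ t, Measurable fun ω => c ω s := fun s hst =>
      measurable_battlingNGD_current hne hcl hK O measurable_const measurable_const
        measurable_const s fun s' hs' => measurable_pi_lambda _ fun i =>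
          measurable_subfamilySigma U (i := (s', i)) (S := {p | p.1 < t}) (lt_of_lt_of_le hs' hst)
    refine (h1 t le_rfl).prodMk (Measurable.prodMk ?_ ?_)
    · exact Finset.measurable_sum _ fun s hs => hdrift.comp (h1 s (Finset.mem_range.1 hs).le)
    · exact Finset.measurable_prod _ fun s hs =>
        (measurable_one.indicator hset).comp (h1 s (Finset.mem_range.1 hs).le)
  have hYm : Measurable[subfamilySigma U {p | p.1 = t}] Y := by
    let _ : MeasurableSpace Ω := subfamilySigma U {p | p.1 = t}
    exact measurable_pi_lambda _ fun i => measurable_subfamilySigma U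
      (i := (t, i)) (S := {p | p.1 = t}) rfl
  have hdisj : Disjoint {p : ℕ × Fin n | p.1 < t} {p | p.1 = t} := by
    rw [Set.disjoint_left]
    intro p hp hp'
    exact (ne_of_lt hp) hp'
  have hXY : IndepFun X Y P := iIndepFun.indepFun_of_subfamilySigma (u := U) hindep hU hdisj hXm hYm
  have hX : Measurable X := hXm.mono (subfamilySigma_le hU _) le_rfl
  have hY : Measurable Y := measurable_pi_lambda _ (hmeas t)
  have hsucc : ∀ ω, phasePotential n β f xstar e T (c ω) (t + 1) = φ (X ω) (Y ω) := by
    intro ω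
    simp only [phasePotential, notHit, accDrift, Finset.prod_range_succ, Finset.sum_range_succ, φ, X,
      ← hQ, ← add_assoc]
    push_cast
    rfl
  calc ∫⁻ ω, phasePotential n β f xstar e T (c ω) (t + 1) ∂P
      = ∫⁻ ω, ∫⁻ ω', φ (X ω) (Y ω') ∂P ∂P := by
        simp only [hsucc]
        exact hXY.lintegral_comp_prodMk hX hY hφ
    _ ≤ ∫⁻ ω, phasePotential n β f xstar e T (c ω) t ∂P := by
        refine lintegral_mono fun ω => ?_
        simp only [φ, phasePotential, ← hQ]
        rw [lintegral_const_mul']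
        swap
        · exact ENNReal.mul_ne_top (notHit_ne_top _ _) (by rw [Set.indicator_apply]; split_ifs <;> simp)
        by_cases hmem : c ω t ∈ {w | e / 4 < f w - f xstar}
        · have hB : 0 ≤ 81 * Q * ((T : ℝ) - (t + 1)) := by
            have : (t : ℝ) + 1 ≤ T := by exact_mod_cast htT
            have : 0 ≤ (T : ℝ) - (t + 1) := by linarith
            positivity
          have hround := lintegral_nextPoint_le hn hnd hα hβ hc hs hcl hK hx hmin O he hmem
            (hmeas t) (hlaw t) (hindep.precomp (g := fun i : Fin n => (t, i))
              (Prod.mk_right_injective t)) (accDrift_nonneg (n := n) (f := f) (xstar := xstar)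
              hβ he (c ω) t) hB
          simp only [X, Set.indicator_of_mem hmem, Pi.one_apply, mul_one]
          gcongr
          refine hround.trans (le_of_eq ?_)
          rw [← hQ]
          congr 1
          ring
        · simp [X, Set.indicator_of_notMem hmem]

/-- If `c` are the points of a phase and `b` is at least as good as all of them, then either `b`
has suboptimality at most `e / 4`, or the final potential bounds it. -/
lemma ofReal_sub_le_phasePotential (hn : 1 ≤ n) (hd : 1 ≤ d) (hβ : 0 < β) {e : ℝ} (he : 0 < e)
    (hmin : ∀ y, f xstar ≤ f y) {T : ℕ} (hT : 1 ≤ T) (c : ℕ → Pt d) (b : Pt d)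
    (hb : ∀ s ≤ T, f b ≤ f (c s)) :
    ENNReal.ofReal (f b - f xstar) ≤ ENNReal.ofReal (e / 4) +
      ENNReal.ofReal (e / (18 * (n * e / (400 * (d * β)) * T)) ^ 2) *
        phasePotential n β f xstar e T c T := by
  have hn' : (0 : ℝ) < n := by exact_mod_cast hn
  have hd' : (0 : ℝ) < d := by exact_mod_cast hd
  have hT' : (0 : ℝ) < T := by exact_mod_cast hT
  set Q := n * e / (400 * (d * β)) with hQ
  have hQ0 : 0 < Q := by positivity
  by_cases hall : ∀ s < T, e / 4 < f (c s) - f xstar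
  · refine le_add_left ?_
    have h1 : notHit f xstar e c T = 1 := Finset.prod_eq_one fun s hs =>
      Set.indicator_of_mem (by exact hall s (Finset.mem_range.1 hs)) _
    have hΔ : 0 ≤ f b - f xstar := sub_nonneg.2 (hmin b)
    have hS : 18 * (Q * T) * Real.sqrt ((f b - f xstar) / e) ≤ accDrift n β f xstar e c T := by
      have h2 : ∑ _s ∈ Finset.range T, 18 * Q * Real.sqrt ((f b - f xstar) / e) ≤
          accDrift n β f xstar e c T := by
        refine Finset.sum_le_sum fun s hs => ?_
        unfold roundDrift
        rw [← hQ]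
        have := hb s (Finset.mem_range.1 hs).le
        gcongr
      rw [Finset.sum_const, Finset.card_range, nsmul_eq_mul] at h2
      linarith
    rw [phasePotential, h1, one_mul, ← ENNReal.ofReal_mul (by positivity)]
    refine ENNReal.ofReal_le_ofReal ?_
    have h3 : (18 * (Q * T) * Real.sqrt ((f b - f xstar) / e)) ^ 2 ≤
        (‖c T - xstar‖ ^ 2 + accDrift n β f xstar e c T) ^ 2 := by
      gcongr
      have := sq_nonneg ‖c T - xstar‖
      linarith
    rw [mul_pow, Real.sq_sqrt (by positivity)] at h3
    have h4 := mul_le_mul_of_nonneg_left h3 (by positivity : 0 ≤ e / (18 * (Q * T)) ^ 2)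
    have h5 : e / (18 * (Q * T)) ^ 2 * ((18 * (Q * T)) ^ 2 * ((f b - f xstar) / e)) =
        f b - f xstar := by field_simp
    rw [h5] at h4
    simpa using h4
  · push Not at hall
    obtain ⟨s, hs, hle⟩ := hall
    refine le_add_right (ENNReal.ofReal_le_ofReal ?_)
    have := hb s hs.le
    linarith

lemma sqrt_two_sub_one_mem_Ioc : Real.sqrt 2 - 1 ∈ Set.Ioc (0 : ℝ) (1 / 2) := by
  constructor
  · have : 1 < Real.sqrt 2 := Real.lt_sqrt_of_sq_lt (by norm_num)
    linarith
  · have : Real.sqrt 2 ≤ 3 / 2 := Real.sqrt_le_iff.2 ⟨by norm_num, by norm_num⟩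
    linarith

/-- The guarantee for a phase: run from `w` with a positive budget `τ`, Battling-NGD attains in
mean the accuracy it is tuned for. -/
lemma lintegral_battlingNGD_best_le [IsProbabilityMeasure P] (hn : 1 ≤ n) (hnd : n ≤ d)
    (hα : 0 < α) (hβ : 0 < β)
    (hc : StrongConvexOn Set.univ α f) (hs : IsSmoothFn β f)
    (hcl : IsClosed K) (hK : Convex ℝ K) (hx : xstar ∈ K) (hmin : ∀ y, f xstar ≤ f y)
    (O : WinnerFeedback n f)
    {u : ℕ → Fin n → Ω → Pt d} (hmeas : ∀ t i, Measurable (u t i))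
    (hlaw : ∀ t i, HasLaw (u t i) (uniformSphere d (1 / Real.sqrt n)) P)
    (hindep : iIndepFun (fun p : ℕ × Fin n => u p.1 p.2) P) (w : Pt d) {τ : ℝ} (hτ : 0 < τ) :
    ∫⁻ ω, ENNReal.ofReal (f (battlingNGD K O
        (learningRate d n β (phaseAccuracy d n β (‖w - xstar‖ ^ 2) τ))
        (perturbation d n α β (phaseAccuracy d n β (‖w - xstar‖ ^ 2) τ)) (fun t i => u t i ω) w
        ⌊τ⌋₊).best - f xstar) ∂P ≤
      ENNReal.ofReal (phaseAccuracy d n β (‖w - xstar‖ ^ 2) τ) := by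
  have hd : 1 ≤ d := hn.trans hnd
  have hn' : (0 : ℝ) < n := by exact_mod_cast hn
  have hd' : (0 : ℝ) < d := by exact_mod_cast hd
  have hnd' : (n : ℝ) ≤ d := by exact_mod_cast hnd
  obtain ⟨hs2, hs2'⟩ := sqrt_two_sub_one_mem_Ioc
  set D := ‖w - xstar‖ ^ 2 with hD
  set e := phaseAccuracy d n β D τ with he
  set T := ⌊τ⌋₊ with hT
  have hD0 : 0 ≤ D := by positivity
  have hΔ := sub_le_of_isSmoothFn hs hmin w
  rw [← hD] at hΔ
  -- if no round is played, or if `w` is the minimiser, then the starting point is good enough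
  by_cases htriv : f w - f xstar ≤ e
  · calc _ ≤ ∫⁻ _ω, ENNReal.ofReal e ∂P := by
          refine lintegral_mono fun ω => ENNReal.ofReal_le_ofReal ?_
          have h1 : f (battlingNGD K O (learningRate d n β e) (perturbation d n α β e)
            (fun t i => u t i ω) w T).best ≤ f w := battlingNGD_best_le (Nat.zero_le T)
          linarith
      _ = ENNReal.ofReal e := by simp
  have heq : e * ((Real.sqrt 2 - 1) * n * τ) = 400 * d * β * D := by
    rw [he, phaseAccuracy]; field_simp
  have hDpos : 0 < D := by
    refine lt_of_le_of_ne hD0 fun h0 => htriv ?_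
    rw [he, phaseAccuracy, ← h0, mul_zero, zero_div]
    rw [← h0] at hΔ
    linarith
  have he0 : 0 < e := by
    rw [he, phaseAccuracy]; positivity
  have hτ1 : 1 ≤ τ := by
    by_contra hlt
    push Not at hlt
    refine htriv (hΔ.trans ?_)
    have h1 : (Real.sqrt 2 - 1) * n * τ ≤ d := by
      calc (Real.sqrt 2 - 1) * n * τ ≤ 1 * n * 1 := by gcongr; linarith
        _ ≤ d := by linarith
    have h2 : 400 * d * β * D ≤ e * d := heq ▸ mul_le_mul_of_nonneg_left h1 he0.le
    have h3 : 400 * β * D ≤ e := by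
      refine le_of_mul_le_mul_right ?_ hd'
      linarith
    have h4 : 0 ≤ β * D := by positivity
    linarith
  have hT1 : 1 ≤ T := Nat.le_floor (by exact_mod_cast hτ1)
  have hT' : (1 : ℝ) ≤ T := by exact_mod_cast hT1
  have hτT : τ ≤ 2 * T := by
    have := Nat.lt_floor_add_one τ
    rw [← hT] at this
    linarith
  set Q := n * e / (400 * (d * β)) with hQ
  have hQ0 : 0 < Q := by positivity
  have hQT : D ≤ Q * T := by
    have h1 : Q * τ * (Real.sqrt 2 - 1) = D := by
      rw [hQ]
      have : n * e / (400 * (d * β)) * τ * (Real.sqrt 2 - 1) =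
        (e * ((Real.sqrt 2 - 1) * n * τ)) / (400 * (d * β)) := by ring
      rw [this, heq]; field_simp
    have h2 : Q * τ * (Real.sqrt 2 - 1) ≤ Q * (2 * T) * (1 / 2) := by gcongr
    linarith
  let c : Ω → ℕ → Pt d := fun ω s => (battlingNGD K O (learningRate d n β e)
    (perturbation d n α β e) (fun t i => u t i ω) w s).current
  have hpot : ∀ t ≤ T, ∫⁻ ω, phasePotential n β f xstar e T (c ω) t ∂P ≤
      ENNReal.ofReal (D ^ 2 + 81 * Q * T * D) := by
    intro t
    induction t with
    | zero =>
      intro _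
      simp [phasePotential, notHit, accDrift, c, battlingNGD, ← hD, ← hQ]
    | succ t ih =>
      intro ht
      exact (lintegral_phasePotential_succ_le hn hnd hα hβ hc hs hcl hK hx hmin O he0 hmeas hlaw
        hindep w (by omega)).trans (ih (by omega))
  calc _ ≤ ∫⁻ ω, (ENNReal.ofReal (e / 4) + ENNReal.ofReal (e / (18 * (Q * T)) ^ 2) *
        phasePotential n β f xstar e T (c ω) T) ∂P :=
        lintegral_mono fun ω => ofReal_sub_le_phasePotential hn hd hβ he0 hmin hT1 (c ω) _
          fun s hs => battlingNGD_best_le hs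
    _ ≤ ENNReal.ofReal (e / 4) + ENNReal.ofReal (e / (18 * (Q * T)) ^ 2) *
        ENNReal.ofReal (D ^ 2 + 81 * Q * T * D) := by
        rw [lintegral_add_left measurable_const, lintegral_const_mul' _ _ ENNReal.ofReal_ne_top]
        simp only [lintegral_const, measure_univ, mul_one]
        gcongr
        exact hpot T le_rfl
    _ ≤ ENNReal.ofReal e := by
        rw [← ENNReal.ofReal_mul (by positivity), ← ENNReal.ofReal_add (by positivity) (by positivity)]
        refine ENNReal.ofReal_le_ofReal ?_
        set x := Q * T with hx'
        have hx0 : 0 < x := by positivity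
        have h1 : D ^ 2 + 81 * Q * T * D ≤ 82 * x ^ 2 := by
          have h2 : D ^ 2 ≤ x ^ 2 := by gcongr
          have h3 : x * D ≤ x * x := by gcongr
          have h4 : 81 * Q * T * D = 81 * (x * D) := by rw [hx']; ring
          rw [h4]; linarith
        have h5 : e / (18 * x) ^ 2 * (D ^ 2 + 81 * Q * T * D) ≤ e / (18 * x) ^ 2 * (82 * x ^ 2) := by
          gcongr
        have h6 : e / (18 * x) ^ 2 * (82 * x ^ 2) = 82 / 324 * e := by field_simp; norm_num
        linarith

end Phase

/-! ### Improved Battling-NGD -/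

section Improved

variable {d n : ℕ} {f : Pt d → ℝ} {α β : ℝ} {xstar w₁ : Pt d} {K : Set (Pt d)}
  {O : WinnerFeedback n f}

/-- The round budgets of the phases do not depend on the sampled directions: that of the first
phase involves the given starting point only, and the later ones are constant. -/
lemma improvedBattlingNGD_succ_fst (u : ℕ → ℕ → Fin n → Pt d) (k : ℕ) :
    (improvedBattlingNGD K O α β xstar u w₁ (k + 1)).1 =
      (battlingNGD K O
        (learningRate d n β (phaseAccuracy d n β
          (‖(improvedBattlingNGD K O α β xstar u w₁ k).1 - xstar‖ ^ 2)
          (phaseBudget d n α β (‖w₁ - xstar‖ ^ 2) k)))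
        (perturbation d n α β (phaseAccuracy d n β
          (‖(improvedBattlingNGD K O α β xstar u w₁ k).1 - xstar‖ ^ 2)
          (phaseBudget d n α β (‖w₁ - xstar‖ ^ 2) k)))
        (u k) (improvedBattlingNGD K O α β xstar u w₁ k).1
        ⌊phaseBudget d n α β (‖w₁ - xstar‖ ^ 2) k⌋₊).best := by
  cases k with
  | zero => rfl
  | succ k => simp [improvedBattlingNGD, phaseBudget]

lemma improvedBattlingNGD_mem (hcl : IsClosed K) (hK : Convex ℝ K) (hw : w₁ ∈ K)
    (u : ℕ → ℕ → Fin n → Pt d) (k : ℕ) :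
    (improvedBattlingNGD K O α β xstar u w₁ k).1 ∈ K := by
  induction k with
  | zero => exact hw
  | succ k ih => exact battlingNGD_mem ⟨_, hw⟩ hcl hK ih _

lemma budgetUnit_nonneg (hα : 0 < α) (hβ : 0 < β) : 0 ≤ budgetUnit d n α β := by
  have := sqrt_two_sub_one_mem_Ioc.1
  unfold budgetUnit
  positivity

lemma budgetUnit_pos (hn : 1 ≤ n) (hd : 1 ≤ d) (hα : 0 < α) (hβ : 0 < β) :
    0 < budgetUnit d n α β := by
  have := sqrt_two_sub_one_mem_Ioc.1
  have hn' : (0 : ℝ) < n := by exact_mod_cast hn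
  have hd' : (0 : ℝ) < d := by exact_mod_cast hd
  unfold budgetUnit
  positivity

lemma improvedBattlingNGD_queries_le (hα : 0 < α) (hβ : 0 < β) (u : ℕ → ℕ → Fin n → Pt d)
    (k : ℕ) : ((improvedBattlingNGD K O α β xstar u w₁ (k + 1)).2 : ℝ) ≤
      2 * budgetUnit d n α β * ‖w₁ - xstar‖ ^ 2 + 4 * budgetUnit d n α β * k := by
  have ht : 0 ≤ budgetUnit d n α β := budgetUnit_nonneg hα hβ
  induction k with
  | zero =>
    have h := Nat.floor_le (mul_nonneg ht (sq_nonneg ‖w₁ - xstar‖))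
    simp only [improvedBattlingNGD, battlingNGD_queries, phaseBudget, if_true, zero_add]
    push_cast
    linarith
  | succ k ih =>
    have h := Nat.floor_le (mul_nonneg (zero_le_two (α := ℝ)) ht)
    rw [improvedBattlingNGD]
    simp only [battlingNGD_queries, phaseBudget, Nat.add_eq_zero_iff, one_ne_zero, and_false,
      if_false]
    push_cast
    linarith

lemma phaseAccuracy_first (hn : 1 ≤ n) (hd : 1 ≤ d) (hα : 0 < α) (hβ : 0 < β) {D : ℝ}
    (hD : 0 < D) : phaseAccuracy d n β D (phaseBudget d n α β D 0) = α / 2 := by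
  have := sqrt_two_sub_one_mem_Ioc.1
  have hn' : (0 : ℝ) < n := by exact_mod_cast hn
  have hd' : (0 : ℝ) < d := by exact_mod_cast hd
  simp only [phaseAccuracy, phaseBudget, if_true, budgetUnit]
  field_simp; norm_num

lemma phaseAccuracy_later (hn : 1 ≤ n) (hd : 1 ≤ d) (hα : 0 < α) (hβ : 0 < β) (D D' : ℝ)
    {k : ℕ} (hk : k ≠ 0) :
    phaseAccuracy d n β D (phaseBudget d n α β D' k) = α * D / 4 := by
  have := sqrt_two_sub_one_mem_Ioc.1
  have hn' : (0 : ℝ) < n := by exact_mod_cast hn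
  have hd' : (0 : ℝ) < d := by exact_mod_cast hd
  simp only [phaseAccuracy, phaseBudget, if_neg hk, budgetUnit]
  field_simp; ring

lemma measurable_improvedBattlingNGD {E : Type*} [MeasurableSpace E] (hf : Measurable f)
    (hcl : IsClosed K) (hK : Convex ℝ K) (hw : w₁ ∈ K) {u : E → ℕ → ℕ → Fin n → Pt d} (k : ℕ)
    (hu : ∀ j < k, ∀ t, Measurable fun x => u x j t) :
    Measurable fun x => (improvedBattlingNGD K O α β xstar (u x) w₁ k).1 := by
  induction k with
  | zero => exact measurable_const
  | succ k ih =>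
    have h1 := ih fun j hj => hu j (by omega)
    simp only [improvedBattlingNGD_succ_fst]
    refine measurable_battlingNGD_best hf ⟨_, hw⟩ hcl hK O ?_ ?_ h1 _ fun t _ => hu k (by omega) t
    · unfold learningRate phaseAccuracy; fun_prop
    · unfold perturbation phaseAccuracy; fun_prop

variable {Ω : Type*} [MeasurableSpace Ω] {P : Measure Ω} [IsProbabilityMeasure P]

/-- Conditionally on the earlier phases, a phase attains in mean the accuracy computed from its
starting point. -/
lemma lintegral_improvedBattlingNGD_succ_le (hn : 1 ≤ n) (hnd : n ≤ d)
    (hα : 0 < α) (hβ : 0 < β)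
    (hc : StrongConvexOn Set.univ α f) (hs : IsSmoothFn β f)
    (hcl : IsClosed K) (hK : Convex ℝ K) (hx : xstar ∈ K) (hmin : ∀ y, f xstar ≤ f y)
    (hw : w₁ ∈ K)
    {u : ℕ → ℕ → Fin n → Ω → Pt d} (hmeas : ∀ k t i, Measurable (u k t i))
    (hlaw : ∀ k t i, HasLaw (u k t i) (uniformSphere d (1 / Real.sqrt n)) P)
    (hindep : iIndepFun (fun p : ℕ × ℕ × Fin n => u p.1 p.2.1 p.2.2) P) (k : ℕ)
    (hτ : 0 < phaseBudget d n α β (‖w₁ - xstar‖ ^ 2) k) :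
    ∫⁻ ω, ENNReal.ofReal (f (improvedBattlingNGD K O α β xstar (fun k t i => u k t i ω) w₁
        (k + 1)).1 - f xstar) ∂P ≤
      ∫⁻ ω, ENNReal.ofReal (phaseAccuracy d n β
        (‖(improvedBattlingNGD K O α β xstar (fun k t i => u k t i ω) w₁ k).1 - xstar‖ ^ 2)
        (phaseBudget d n α β (‖w₁ - xstar‖ ^ 2) k)) ∂P := by
  have hf : Measurable f := hs.1.continuous.measurable
  set τ := phaseBudget d n α β (‖w₁ - xstar‖ ^ 2) k
  let X : Ω → Pt d := fun ω =>
    (improvedBattlingNGD K O α β xstar (fun k t i => u k t i ω) w₁ k).1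
  let Y : Ω → ℕ → Fin n → Pt d := fun ω t i => u k t i ω
  let φ : Pt d → (ℕ → Fin n → Pt d) → ENNReal := fun x v => ENNReal.ofReal (f (battlingNGD K O
    (learningRate d n β (phaseAccuracy d n β (‖x - xstar‖ ^ 2) τ))
    (perturbation d n α β (phaseAccuracy d n β (‖x - xstar‖ ^ 2) τ)) v x ⌊τ⌋₊).best - f xstar)
  have hφ : Measurable (Function.uncurry φ) := by
    refine ENNReal.measurable_ofReal.comp (Measurable.sub_const (hf.comp ?_) _)
    refine measurable_battlingNGD_best (w := fun z : Pt d × (ℕ → Fin n → Pt d) => z.1)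
      (u := fun z => z.2) hf ⟨_, hx⟩ hcl hK O ?_ ?_ measurable_fst _ fun t _ => ?_
    · unfold learningRate phaseAccuracy; fun_prop
    · unfold perturbation phaseAccuracy; fun_prop
    · exact (measurable_pi_apply t).comp measurable_snd
  let U : ℕ × ℕ × Fin n → Ω → Pt d := fun p => u p.1 p.2.1 p.2.2
  have hU : ∀ p, Measurable (U p) := fun p => hmeas p.1 p.2.1 p.2.2
  have hXm : Measurable[subfamilySigma U {p | p.1 < k}] X := by
    let _ : MeasurableSpace Ω := subfamilySigma U {p | p.1 < k}
    exact measurable_improvedBattlingNGD hf hcl hK hw k fun j hj t => measurable_pi_lambda _ fun i =>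
      measurable_subfamilySigma U (i := (j, t, i)) (S := {p | p.1 < k}) hj
  have hYm : Measurable[subfamilySigma U {p | p.1 = k}] Y := by
    let _ : MeasurableSpace Ω := subfamilySigma U {p | p.1 = k}
    exact measurable_pi_lambda _ fun t => measurable_pi_lambda _ fun i =>
      measurable_subfamilySigma U (i := (k, t, i)) (S := {p | p.1 = k}) rfl
  have hdisj : Disjoint {p : ℕ × ℕ × Fin n | p.1 < k} {p | p.1 = k} := by
    rw [Set.disjoint_left]
    intro p hp hp'
    exact (ne_of_lt hp) hp'
  have hXY : IndepFun X Y P := iIndepFun.indepFun_of_subfamilySigma (u := U) hindep hU hdisj hXm hYm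
  have hX : Measurable X := hXm.mono (subfamilySigma_le hU _) le_rfl
  have hY : Measurable Y := hYm.mono (subfamilySigma_le hU _) le_rfl
  calc _ = ∫⁻ ω, φ (X ω) (Y ω) ∂P := by
        congr 1; ext ω
        rw [improvedBattlingNGD_succ_fst]
    _ = ∫⁻ ω, ∫⁻ ω', φ (X ω) (Y ω') ∂P ∂P := hXY.lintegral_comp_prodMk hX hY hφ
    _ ≤ _ := by
        refine lintegral_mono fun ω => ?_
        exact lintegral_battlingNGD_best_le hn hnd hα hβ hc hs hcl hK hx hmin O (hmeas k) (hlaw k)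
          (hindep.precomp (g := fun p : ℕ × Fin n => (k, p)) (Prod.mk_right_injective k)) (X ω) hτ

/-- The mean suboptimality is at most `α / 2` after the first phase and is halved by each further
one, since by strong convexity the accuracy of a phase is at most half the suboptimality of its
starting point. -/
lemma lintegral_improvedBattlingNGD_le (hn : 1 ≤ n) (hnd : n ≤ d)
    (hα : 0 < α) (hβ : 0 < β)
    (hc : StrongConvexOn Set.univ α f) (hs : IsSmoothFn β f)
    (hcl : IsClosed K) (hK : Convex ℝ K) (hx : xstar ∈ K) (hmin : ∀ y, f xstar ≤ f y)
    (hw : w₁ ∈ K)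
    {u : ℕ → ℕ → Fin n → Ω → Pt d} (hmeas : ∀ k t i, Measurable (u k t i))
    (hlaw : ∀ k t i, HasLaw (u k t i) (uniformSphere d (1 / Real.sqrt n)) P)
    (hindep : iIndepFun (fun p : ℕ × ℕ × Fin n => u p.1 p.2.1 p.2.2) P) (k : ℕ) :
    ∫⁻ ω, ENNReal.ofReal (f (improvedBattlingNGD K O α β xstar (fun k t i => u k t i ω) w₁
        (k + 1)).1 - f xstar) ∂P ≤ ENNReal.ofReal (α / 2 ^ (k + 1)) := by
  have hd : 1 ≤ d := hn.trans hnd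
  have hunit := budgetUnit_pos hn hd hα hβ
  induction k with
  | zero =>
    rcases eq_or_lt_of_le (sq_nonneg ‖w₁ - xstar‖) with h0 | h0
    · have hw0 : w₁ = xstar := by
        simpa [sub_eq_zero] using h0.symm
      have hle : ∀ ω, f (improvedBattlingNGD K O α β xstar (fun k t i => u k t i ω) w₁
          (0 + 1)).1 - f xstar ≤ 0 := by
        intro ω
        rw [improvedBattlingNGD_succ_fst, sub_nonpos, ← hw0]
        exact battlingNGD_best_le (Nat.zero_le _)
      simp [ENNReal.ofReal_of_nonpos (hle _)]
    · refine (lintegral_improvedBattlingNGD_succ_le hn hnd hα hβ hc hs hcl hK hx hmin hw hmeas hlaw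
        hindep 0 (by simpa [phaseBudget] using mul_pos hunit h0)).trans ?_
      simp only [improvedBattlingNGD]
      rw [phaseAccuracy_first hn hd hα hβ h0]
      simp
  | succ k ih =>
    refine (lintegral_improvedBattlingNGD_succ_le hn hnd hα hβ hc hs hcl hK hx hmin hw hmeas hlaw
        hindep (k + 1) (by simpa [phaseBudget] using hunit)).trans ?_
    calc _ ≤ ∫⁻ ω, ENNReal.ofReal (1 / 2) * ENNReal.ofReal (f (improvedBattlingNGD K O α β xstar
          (fun k t i => u k t i ω) w₁ (k + 1)).1 - f xstar) ∂P := by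
          refine lintegral_mono fun ω => ?_
          rw [← ENNReal.ofReal_mul (by norm_num), phaseAccuracy_later hn hd hα hβ _ _ k.succ_ne_zero]
          refine ENNReal.ofReal_le_ofReal ?_
          have := le_sub_of_strongConvexOn hc hmin (improvedBattlingNGD K O α β xstar
            (fun k t i => u k t i ω) w₁ (k + 1)).1
          linarith
      _ ≤ ENNReal.ofReal (1 / 2) * ENNReal.ofReal (α / 2 ^ (k + 1)) := by
          rw [lintegral_const_mul' _ _ ENNReal.ofReal_ne_top]
          gcongr
      _ = ENNReal.ofReal (α / 2 ^ (k + 1 + 1)) := by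
          rw [← ENNReal.ofReal_mul (by norm_num)]
          congr 1
          rw [pow_succ 2 (k + 1)]; field_simp

end Improved

lemma exists_phaseCount_eq_succ (α ε : ℝ) (hα : 0 < α) (hε : 0 < ε) :
    ∃ k : ℕ, phaseCount α ε = k + 1 ∧ α / 2 ^ (k + 1) ≤ ε ∧
      (k : ℝ) ≤ max (Real.logb 2 (α / ε)) 0 := by
  obtain ⟨k, hk⟩ : ∃ k, phaseCount α ε = k + 1 :=
    ⟨phaseCount α ε - 1, (Nat.sub_add_cancel (le_max_left _ _)).symm⟩
  refine ⟨k, hk, ?_, ?_⟩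
  · have h1 : Real.logb 2 (α / ε) ≤ (k + 1 : ℕ) := by
      rw [← hk]
      exact (Nat.le_ceil _).trans (by exact_mod_cast le_max_right _ _)
    rw [Real.logb_le_iff_le_rpow (by norm_num) (by positivity), Real.rpow_natCast,
      div_le_iff₀ hε] at h1
    rw [div_le_iff₀ (by positivity)]
    linarith
  · rcases le_or_gt (Real.logb 2 (α / ε)) 0 with h | h
    · have : phaseCount α ε = 1 := by simp [phaseCount, Nat.ceil_eq_zero.2 h]
      obtain rfl : k = 0 := by omega
      simp
    · refine le_max_of_le_left ?_
      have h1 := Nat.ceil_lt_add_one h.le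
      have h2 : 1 ≤ ⌈Real.logb 2 (α / ε)⌉₊ := Nat.ceil_pos.2 h
      rw [phaseCount, max_eq_right h2] at hk
      rw [hk] at h1
      push_cast at h1
      linarith

theorem mainTheorem4 :
    ∃ C : ℝ, 0 < C ∧
      ∀ (d m : ℕ) (_ : 2 ≤ m) (_ : Nat.log 2 m ≤ d)
        (α β ε : ℝ) (_ : 0 < α) (_ : 0 < β) (_ : 0 < ε)
        (f : Pt d → ℝ) (_ : StrongConvexOn Set.univ α f) (_ : IsSmoothFn β f)
        (K : Set (Pt d)) (_ : IsClosed K) (_ : Convex ℝ K)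
        (xstar : Pt d) (_ : xstar ∈ K) (_ : ∀ y : Pt d, f xstar ≤ f y)
        (w₁ : Pt d) (_ : w₁ ∈ K)
        (O : WinnerFeedback (Nat.log 2 m) f)
        (Ω : Type*) [MeasurableSpace Ω] (P : Measure Ω) [IsProbabilityMeasure P]
        (u : ℕ → ℕ → Fin (Nat.log 2 m) → Ω → Pt d)
        (_ : ∀ k t i, HasLaw (u k t i) (uniformSphere d (1 / Real.sqrt (Nat.log 2 m))) P)
        (_ : iIndepFun (fun p : ℕ × ℕ × Fin (Nat.log 2 m) => u p.1 p.2.1 p.2.2) P),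
        let run : Ω → Pt d × ℕ := fun ω =>
          improvedBattlingNGD K O α β xstar (fun k t i => u k t i ω) w₁ (phaseCount α ε)
        (∀ ω, (run ω).1 ∈ K) ∧
        Integrable (fun ω => f (run ω).1) P ∧
        (∫ ω, f (run ω).1 ∂P) - f xstar ≤ ε ∧
        ∀ ω, ((run ω).2 : ℝ) ≤
          C * (d * β / (α * (Nat.log 2 m : ℝ)) *
            (max (Real.logb 2 (α / ε)) 0 + ‖w₁ - xstar‖ ^ 2)) := by
  have hsq := sqrt_two_sub_one_mem_Ioc.1
  refine ⟨3200 / (Real.sqrt 2 - 1), by positivity, ?_⟩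
  intro d m hm hmd
  have hn : 1 ≤ Nat.log 2 m := Nat.log_pos one_lt_two hm
  generalize Nat.log 2 m = n at hn hmd ⊢
  intro α β ε hα hβ hε f hc hs K hcl hK xstar hx hmin w₁ hw O Ω _ P _ u hlaw hindep run
  obtain ⟨k, hk, hkε, hklog⟩ := exists_phaseCount_eq_succ α ε hα hε
  -- the directions are only almost everywhere measurable, so pass to measurable modifications
  let u' : ℕ → ℕ → Fin n → Ω → Pt d := fun k t i => (hlaw k t i).aemeasurable.mk
  have hae : ∀ k t i, u k t i =ᵐ[P] u' k t i := fun k t i => (hlaw k t i).aemeasurable.ae_eq_mk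
  have hmeas' : ∀ k t i, Measurable (u' k t i) := fun k t i =>
    (hlaw k t i).aemeasurable.measurable_mk
  have hlaw' : ∀ k t i, HasLaw (u' k t i) (uniformSphere d (1 / Real.sqrt n)) P := fun k t i =>
    (hlaw k t i).congr (hae k t i).symm
  have hindep' : iIndepFun (fun p : ℕ × ℕ × Fin n => u' p.1 p.2.1 p.2.2) P :=
    hindep.congr fun p => hae p.1 p.2.1 p.2.2
  let x' : Ω → Pt d := fun ω =>
    (improvedBattlingNGD K O α β xstar (fun k t i => u' k t i ω) w₁ (k + 1)).1
  have hx' : Measurable x' := measurable_improvedBattlingNGD hs.1.continuous.measurable hcl hK hw _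
    fun j _ t => measurable_pi_lambda _ fun i => hmeas' j t i
  have hrun : (fun ω => f (run ω).1) =ᵐ[P] fun ω => f (x' ω) := by
    have hall : ∀ᵐ ω ∂P, ∀ k t i, u k t i ω = u' k t i ω :=
      ae_all_iff.2 fun k => ae_all_iff.2 fun t => ae_all_iff.2 fun i => hae k t i
    filter_upwards [hall] with ω hω
    simp only [run, x', hk, hω]
  have hbound : ∫⁻ ω, ENNReal.ofReal (f (x' ω) - f xstar) ∂P ≤ ENNReal.ofReal ε :=
    (lintegral_improvedBattlingNGD_le hn hmd hα hβ hc hs hcl hK hx hmin hw hmeas' hlaw' hindep'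
      k).trans (ENNReal.ofReal_le_ofReal hkε)
  have hfm : Measurable fun ω => f (x' ω) := hs.1.continuous.measurable.comp hx'
  have hnonneg : ∀ ω, 0 ≤ f (x' ω) - f xstar := fun ω => sub_nonneg.2 (hmin _)
  have hint : Integrable (fun ω => f (x' ω) - f xstar) P := by
    refine ⟨(hfm.sub_const _).aestronglyMeasurable, ?_⟩
    rw [hasFiniteIntegral_iff_ofReal (Filter.Eventually.of_forall hnonneg)]
    exact hbound.trans_lt ENNReal.ofReal_lt_top
  have hint' : Integrable (fun ω => f (x' ω)) P := by
    refine (hint.add (integrable_const (f xstar))).congr (Filter.Eventually.of_forall fun ω => ?_)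
    simp
  refine ⟨fun ω => improvedBattlingNGD_mem hcl hK hw _ _, hint'.congr hrun.symm, ?_, fun ω => ?_⟩
  · rw [integral_congr_ae hrun]
    have h1 : ∫ ω, (f (x' ω) - f xstar) ∂P = (∫ ω, f (x' ω) ∂P) - f xstar := by
      rw [integral_sub hint' (integrable_const _)]; simp
    rw [← h1, integral_eq_lintegral_of_nonneg_ae (Filter.Eventually.of_forall hnonneg)
      (hfm.sub_const _).aestronglyMeasurable]
    exact ENNReal.toReal_le_of_le_ofReal hε.le hbound
  · simp only [run, hk]
    refine (improvedBattlingNGD_queries_le hα hβ _ k).trans ?_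
    have ht := budgetUnit_nonneg (d := d) (n := n) hα hβ
    have h1 : 3200 / (Real.sqrt 2 - 1) * (d * β / (α * n) *
        (max (Real.logb 2 (α / ε)) 0 + ‖w₁ - xstar‖ ^ 2)) =
        4 * budgetUnit d n α β * (max (Real.logb 2 (α / ε)) 0 + ‖w₁ - xstar‖ ^ 2) := by
      rw [budgetUnit]; field_simp; ring
    rw [h1]
    have h2 : 4 * budgetUnit d n α β * k ≤
        4 * budgetUnit d n α β * max (Real.logb 2 (α / ε)) 0 := by gcongr
    have h3 : 0 ≤ budgetUnit d n α β * ‖w₁ - xstar‖ ^ 2 := by positivity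
    linarith
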